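/- There is an absolute constant $c>0$ such that the following holds for every $n\ge 2$ and every random vector $X=(X_1,\dots,X_n)$ in $\mathbb R^n$, defined on a probability space $(\Omega,\mathfrak F,\mathbb P)$, which is isotropic, i.e. $\mathbb E X_iX_j=\delta_{ij}$ for all $i,j\le n$. Let $\mathbb E_\theta$ denote integration over the unit sphere $\mathbb S^{n-1}$ of $\mathbb R^n$ with respect to the normalized Lebesgue (uniform probability) measure. For $\theta\in\mathbb S^{n-1}$ let $F_\theta(x)=\mathbb P\{\theta_1X_1+\dots+\theta_nX_n\le x\}$, let $\Phi(x)=\frac1{\sqrt{2\pi}}\int_{-\infty}^x e^{-y^2/2}\,dy$, let $\rho(F_\theta,\Phi)=\sup_{x\in\mathbb R}|F_\theta(x)-\Phi(x)|$, and put, with $|X|$ the Euclidean norm, $$\sigma_{2p}=\sqrt n\,\Big(\mathbb E\,\Big|\frac{|X|^2}{n}-1\Big|^p\Big)^{1/p}\qquad(p\ge 1).$$ Then $\theta\mapsto\rho^2(F_\theta,\Phi)$ is integrable and $$\mathbb E_\theta\,\rho^2(F_\theta,\Phi)\;\le\; c\,(1+\sigma_2^2)\,\frac{(\log n)^2}{n}.$$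 Consequently, if $\mathbb E|X|^4<\infty$, then $\theta\mapsto\rho(F_\theta,\Phi)$ is integrable and $$\mathbb E_\theta\,\rho(F_\theta,\Phi)\;\le\;\big(\mathbb E_\theta\,\rho^2(F_\theta,\Phi)\big)^{1/2}\;\le\; c\,(1+\sigma_4)\,\frac{\log n}{\sqrt n},$$ which sharpens the known bound $\mathbb E_\theta\,\rho(F_\theta,\Phi)\le c\,(1+\sigma_4)\,\frac{\log n}{\sqrt n}$. -/

import Mathlib

open MeasureTheory

noncomputable section

namespace RandomizedCLT

/-- The normalized Lebesgue (uniform) probability measure `σ_{n-1}` on the unit sphere of `ℝⁿ`: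
the surface measure induced by Lebesgue measure, divided by its total mass. -/
def sphereMeasure (n : ℕ) :
    Measure (Metric.sphere (0 : EuclideanSpace ℝ (Fin n)) 1) :=
  ((volume : Measure (EuclideanSpace ℝ (Fin n))).toSphere Set.univ)⁻¹ •
    (volume : Measure (EuclideanSpace ℝ (Fin n))).toSphere

/-- A random vector `X` in `ℝⁿ` on `(Ω, P)` is isotropic if `E X_i X_j = δ_{ij}` for all `i, j`. -/
structure IsIsotropic {n : ℕ} {Ω : Type*} [MeasurableSpace Ω]
    (X : Ω → EuclideanSpace ℝ (Fin n)) (P : Measure Ω) : Prop where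
  aemeasurable : AEMeasurable X P
  integrable : ∀ i j, Integrable (fun ω => X ω i * X ω j) P
  integral_eq : ∀ i j, ∫ ω, X ω i * X ω j ∂P = if i = j then 1 else 0

/-- The distribution function `F_θ(x) = P{⟨X, θ⟩ ≤ x}` of the weighted sum `S_θ = ⟨X, θ⟩`. -/
def weightedSumCDF {n : ℕ} {Ω : Type*} [MeasurableSpace Ω]
    (X : Ω → EuclideanSpace ℝ (Fin n)) (P : Measure Ω)
    (θ : Metric.sphere (0 : EuclideanSpace ℝ (Fin n)) 1) (x : ℝ) : ℝ :=
  P.real {ω | ∑ i, (θ : EuclideanSpace ℝ (Fin n)) i * X ω i ≤ x}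

/-- The standard normal distribution function `Φ`. -/
def normalCDF (x : ℝ) : ℝ :=
  1 / Real.sqrt (2 * Real.pi) * ∫ y in Set.Iic x, Real.exp (-y ^ 2 / 2)

/-- The Kolmogorov distance `ρ(F, G) = sup_x |F(x) - G(x)|`
(the supremum is over a set bounded by `1` when `F`, `G` are distribution functions). -/
def kolmogorovDist (F G : ℝ → ℝ) : ℝ := ⨆ x : ℝ, |F x - G x|

/-- The variance-type functional
`sigma p X P = σ_{2p}(X) = √n (E | |X|²/n - 1 |^p)^{1/p}`, where `|·|` is the Euclidean norm.
So `σ_2 = sigma 1 X P` and `σ_4 = sigma 2 X P`. It is used only when the expectation is finite. -/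
def sigma (p : ℝ) {n : ℕ} {Ω : Type*} [MeasurableSpace Ω]
    (X : Ω → EuclideanSpace ℝ (Fin n)) (P : Measure Ω) : ℝ :=
  Real.sqrt n * (∫ ω, |‖X ω‖ ^ 2 / n - 1| ^ p ∂P) ^ (1 / p)

end RandomizedCLT

end

noncomputable section

namespace RandomizedCLT

open ProbabilityTheory Set Filter Topology
open scoped RealInnerProductSpace ENNReal

set_option linter.unusedSectionVars false

/-! Write `δ = normDeviation`, so that `σ_2² = n δ²` and the target is a bound of order `(1/n + δ²)
(log n)²`.

Replace `θ` by a standard Gaussian vector `Z`, which in polar coordinates has a uniform direction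
independent of its length. Passing from `⟨X, θ⟩` to `⟨X, Z⟩ / √n` rescales the line by `|Z| / √n`.
Since `Φ` is Lipschitz under changes of scale, this costs `2 | |Z|/√n - 1 |`, whose mean square is
`O(1/n)` (`kolmogorovDist_projLaw_le`, `lintegral_norm_div_sqrt_sub_one_sq_le`,
`lintegral_sphere_le_lintegral_stdGaussian`).

For Gaussian directions everything is explicit. With `s = τ²/2` and `Y` an independent copy of `X`,
the mean square over `Z` of the difference between the characteristic function of `⟨X, Z⟩ / √n` at
`τ` and `exp (-s)` is `E exp (-s|X-Y|²/n) - 2 exp (-s) E exp (-s|X|²/n) + exp (-2s)`. Expanding in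
`⟨X, Y⟩ / n` to first order leaves a square of size `δ²`, a linear term controlled by Bessel's
inequality, and a remainder controlled by `E ⟨X, Y⟩² = n` and `δ²`. The total is `O((1/n + δ²)
min(1, s))`, uniformly in `s` (`integral_prod_weight_sub_le`).

A smoothing inequality with the Cauchy kernel (`kolmogorovDist_le_fourierGap`) turns this into a
bound on the Kolmogorov distance with error `8/T`. Cauchy–Schwarz in the frequency, against a weight
of mass `O(log T)`, gives the factor `(2 + log T)²` (`lintegral_sq_fourierGap_le`), and `T = n`
finishes. -/

/-! ### Smoothing inequality with the Cauchy kernel -/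

lemma integral_cos_mul_mul_exp_neg (u : ℝ) :
    ∫ t in Ioi (0 : ℝ), Real.cos (t * u) * Real.exp (-t) = (1 + u ^ 2)⁻¹ := by
  have h := integral_exp_mul_complex_Ioi (a := -1 + u * Complex.I) (by simp) 0
  have h2 : ∀ t : ℝ, Real.cos (t * u) * Real.exp (-t) =
      RCLike.re (Complex.exp ((-1 + u * Complex.I) * t)) := by
    intro t
    rw [RCLike.re_eq_complex_re, Complex.exp_re]
    simp [mul_comm]
  simp_rw [h2]
  rw [integral_re (integrableOn_exp_mul_complex_Ioi (by simp) 0), h]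
  simp [Complex.div_re, Complex.normSq_apply]
  rw [← sq]

lemma abs_sin_mul_div_le {t : ℝ} (ht : 0 < t) (u : ℝ) : |Real.sin (t * u) / t| ≤ |u| := by
  rw [abs_div, abs_of_pos ht, div_le_iff₀ ht]
  calc |Real.sin (t * u)| ≤ |t * u| := Real.abs_sin_le_abs
    _ = |u| * t := by rw [abs_mul, abs_of_pos ht, mul_comm]

lemma integrableOn_exp_neg_Ioi : IntegrableOn (fun t : ℝ => Real.exp (-t)) (Ioi 0) := by
  simpa using exp_neg_integrableOn_Ioi 0 one_pos

lemma integrableOn_sin_mul_div_mul_exp_neg (u : ℝ) :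
    IntegrableOn (fun t : ℝ => Real.sin (t * u) / t * Real.exp (-t)) (Ioi 0) := by
  refine Integrable.mono' (integrableOn_exp_neg_Ioi.const_mul |u|)
    (Measurable.aestronglyMeasurable (by fun_prop)) ?_
  filter_upwards [ae_restrict_mem measurableSet_Ioi] with t ht
  rw [Real.norm_eq_abs, abs_mul, Real.abs_exp]
  exact mul_le_mul_of_nonneg_right (abs_sin_mul_div_le ht u) (Real.exp_pos _).le

/-- The arctangent as a sine transform. -/
lemma integral_sin_mul_div_mul_exp_neg (u : ℝ) :
    ∫ t in Ioi (0 : ℝ), Real.sin (t * u) / t * Real.exp (-t) = Real.arctan u := by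
  set F : ℝ → ℝ := fun u => ∫ t in Ioi (0 : ℝ), Real.sin (t * u) / t * Real.exp (-t) with hF
  have hd : ∀ u, HasDerivAt F (1 + u ^ 2)⁻¹ u := by
    intro u
    rw [← integral_cos_mul_mul_exp_neg u]
    refine (hasDerivAt_integral_of_dominated_loc_of_deriv_le
      (F' := fun u t => Real.cos (t * u) * Real.exp (-t))
      (bound := fun t => Real.exp (-t)) (Metric.ball_mem_nhds u one_pos) ?_ ?_ ?_ ?_
      integrableOn_exp_neg_Ioi ?_).2
    · exact Eventually.of_forall fun v => (integrableOn_sin_mul_div_mul_exp_neg v).1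
    · exact integrableOn_sin_mul_div_mul_exp_neg u
    · exact Measurable.aestronglyMeasurable (by fun_prop)
    · refine Eventually.of_forall fun t v _ => ?_
      rw [Real.norm_eq_abs, abs_mul, Real.abs_exp]
      exact mul_le_of_le_one_left (Real.exp_pos _).le (Real.abs_cos_le_one _)
    · filter_upwards [ae_restrict_mem measurableSet_Ioi] with t ht v _
      have ht' : t ≠ 0 := (ne_of_gt ht)
      have := (((Real.hasDerivAt_sin (t * v)).comp v ((hasDerivAt_id v).const_mul t)).div_const
        t).mul_const (Real.exp (-t))
      convert! this using 1
      field_simp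
  have hd2 : ∀ u, HasDerivAt (fun u => F u - Real.arctan u) 0 u := fun u => by
    have := (hd u).sub (Real.hasDerivAt_arctan' u)
    rw [sub_self] at this
    exact this
  have := is_const_of_deriv_eq_zero (fun u => (hd2 u).differentiableAt) (fun u => (hd2 u).deriv) u 0
  simp [hF] at this
  simpa [hF] using sub_eq_zero.1 this

lemma measurable_real_Iic (μ : Measure ℝ) [IsFiniteMeasure μ] :
    Measurable fun x : ℝ => μ.real (Iic x) :=
  Monotone.measurable fun _ _ h => measureReal_mono (Iic_subset_Iic.2 h)

/-- Since `arctan + π/2` is the primitive of the Cauchy kernel from `-∞`, Fubini identifies its mean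
with the distribution function smoothed at scale `1/T`. -/
lemma integral_arctan_add_pi_div_two (μ : Measure ℝ) [IsProbabilityMeasure μ] {T : ℝ} (hT : 0 < T)
    (x : ℝ) :
    ∫ y, (Real.arctan (T * (x - y)) + Real.pi / 2) ∂μ =
      ∫ s, μ.real (Iic (x - s / T)) * (1 + s ^ 2)⁻¹ := by
  set S : Set (ℝ × ℝ) := {p | p.1 ≤ x - p.2 / T}
  have hS : MeasurableSet S := measurableSet_le (by fun_prop) (by fun_prop)
  have h1 : ∀ y, Real.arctan (T * (x - y)) + Real.pi / 2 =
      ∫ s, S.indicator (fun p => (1 + p.2 ^ 2)⁻¹) (y, s) := by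
    intro y
    rw [← integral_Iic_inv_one_add_sq, ← integral_indicator measurableSet_Iic]
    congr 1 with s
    simp only [indicator, mem_Iic, S, mem_ofPred_eq]
    congr 1
    rw [eq_iff_iff, le_sub_comm, div_le_iff₀ hT, mul_comm]
  simp_rw [h1]
  rw [integral_integral_swap (f := fun y s => S.indicator (fun p => (1 + p.2 ^ 2)⁻¹) (y, s))]
  · congr 1 with s
    have : ∀ y, S.indicator (fun p => (1 + p.2 ^ 2)⁻¹) (y, s) =
        (Iic (x - s / T)).indicator (fun _ => (1 + s ^ 2)⁻¹) y := fun y => by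
      simp [indicator, S]
    simp_rw [this]
    rw [integral_indicator_const _ measurableSet_Iic, smul_eq_mul]
  · refine Integrable.indicator ?_ hS
    exact (integrable_inv_one_add_sq).comp_snd μ

lemma integrable_real_Iic_mul (μ : Measure ℝ) [IsProbabilityMeasure μ] (T x : ℝ) :
    Integrable fun s : ℝ => μ.real (Iic (x - s / T)) * (1 + s ^ 2)⁻¹ := by
  refine integrable_inv_one_add_sq.bdd_mul (c := 1)
    ((measurable_real_Iic μ).comp (by fun_prop)).aestronglyMeasurable
    (Eventually.of_forall fun s => ?_)
  rw [Real.norm_eq_abs, abs_of_nonneg measureReal_nonneg]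
  exact measureReal_le_one

lemma integrable_arctan (μ : Measure ℝ) [IsFiniteMeasure μ] (T x : ℝ) :
    Integrable (fun y => Real.arctan (T * (x - y))) μ := by
  refine Integrable.of_bound (Measurable.aestronglyMeasurable (by fun_prop)) (Real.pi / 2)
    (Eventually.of_forall fun y => ?_)
  rw [Real.norm_eq_abs, abs_le]
  exact ⟨(Real.neg_pi_div_two_lt_arctan _).le, (Real.arctan_lt_pi_div_two _).le⟩

/-- Fubini applied to the sine transform of `arctan`. The first moment gives absolute integrability
near `t = 0`, through `|sin (t u) / t| ≤ |u|`. -/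
lemma integral_arctan_eq (μ : Measure ℝ) [IsProbabilityMeasure μ] (hμ : Integrable id μ)
    (T x : ℝ) :
    ∫ y, Real.arctan (T * (x - y)) ∂μ =
      ∫ t in Ioi (0 : ℝ), (∫ y, Real.sin (t * (T * (x - y))) ∂μ) / t * Real.exp (-t) := by
  simp_rw [← integral_sin_mul_div_mul_exp_neg]
  rw [integral_integral_swap]
  · congr 1 with t
    rw [← integral_div, ← integral_mul_const]
  · have hb : Integrable (fun p : ℝ × ℝ => |T * (x - p.1)| * Real.exp (-p.2))
        (μ.prod (volume.restrict (Ioi 0))) :=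
      Integrable.mul_prod (f := fun y => |T * (x - y)|) (g := fun t => Real.exp (-t))
        ((((integrable_const x).sub hμ).const_mul T).abs) integrableOn_exp_neg_Ioi
    refine Integrable.mono' hb (Measurable.aestronglyMeasurable (by fun_prop)) ?_
    have : ∀ᵐ p ∂(μ.prod (volume.restrict (Ioi (0 : ℝ)))), p.2 ∈ Ioi (0 : ℝ) :=
      Measure.quasiMeasurePreserving_snd.ae (ae_restrict_mem measurableSet_Ioi)
    filter_upwards [this] with p hp
    simp only [Function.uncurry]
    rw [Real.norm_eq_abs, abs_mul, Real.abs_exp]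
    exact mul_le_mul_of_nonneg_right (abs_sin_mul_div_le hp _) (Real.exp_pos _).le

lemma integral_sin_eq_im (μ : Measure ℝ) [IsProbabilityMeasure μ] (τ x : ℝ) :
    ∫ y, Real.sin (τ * (x - y)) ∂μ =
      (Complex.exp (τ * x * Complex.I) * (starRingEnd ℂ) (charFun μ τ)).im := by
  have hi : Integrable (fun y : ℝ => Complex.exp (τ * (x - y) * Complex.I)) μ := by
    refine Integrable.of_bound (Measurable.aestronglyMeasurable (by fun_prop)) 1
      (Eventually.of_forall fun y => ?_)
    have := Complex.norm_exp_ofReal_mul_I (τ * (x - y))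
    push_cast at this
    exact this.le
  rw [charFun_apply_real, ← integral_conj, ← integral_const_mul]
  have : ∀ y : ℝ, Complex.exp (τ * x * Complex.I) *
      (starRingEnd ℂ) (Complex.exp (τ * y * Complex.I)) =
      Complex.exp (τ * (x - y) * Complex.I) := by
    intro y
    rw [← Complex.exp_conj, ← Complex.exp_add]
    congr 1
    simp
    ring
  simp_rw [this]
  rw [← RCLike.im_eq_complex_im, ← integral_im hi]
  congr 1 with y
  rw [RCLike.im_eq_complex_im]
  have := Complex.exp_ofReal_mul_I_im (τ * (x - y))
  push_cast at this
  exact this.symm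

lemma abs_integral_sin_sub_le (μ ν : Measure ℝ) [IsProbabilityMeasure μ] [IsProbabilityMeasure ν]
    (τ x : ℝ) :
    |∫ y, Real.sin (τ * (x - y)) ∂μ - ∫ y, Real.sin (τ * (x - y)) ∂ν| ≤
      ‖charFun μ τ - charFun ν τ‖ := by
  rw [integral_sin_eq_im, integral_sin_eq_im, ← Complex.sub_im, ← mul_sub, ← map_sub]
  refine (Complex.abs_im_le_norm _).trans ?_
  rw [norm_mul, RCLike.norm_conj]
  have := Complex.norm_exp_ofReal_mul_I (τ * x)
  push_cast at this
  rw [this, one_mul]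

lemma integrableOn_integral_sin (μ : Measure ℝ) [IsProbabilityMeasure μ] (hμ : Integrable id μ)
    (T x : ℝ) :
    IntegrableOn (fun t => (∫ y, Real.sin (t * (T * (x - y))) ∂μ) / t * Real.exp (-t))
      (Ioi 0) := by
  have hb : Integrable (fun y => |T * (x - y)|) μ :=
    (((integrable_const x).sub hμ).const_mul T).abs
  refine Integrable.mono' (integrableOn_exp_neg_Ioi.const_mul (∫ y, |T * (x - y)| ∂μ)) ?_ ?_
  · have : Measurable (fun t : ℝ => ∫ y, Real.sin (t * (T * (x - y))) ∂μ) :=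
      (StronglyMeasurable.integral_prod_right (f := fun t y => Real.sin (t * (T * (x - y))))
        (Measurable.stronglyMeasurable (by fun_prop))).measurable
    exact Measurable.aestronglyMeasurable (by fun_prop)
  · filter_upwards [ae_restrict_mem measurableSet_Ioi] with t ht
    rw [Real.norm_eq_abs, abs_mul, Real.abs_exp, ← integral_div]
    gcongr
    refine (abs_integral_le_integral_abs).trans
      (integral_mono_of_nonneg (Eventually.of_forall fun _ => abs_nonneg _) hb
        (Eventually.of_forall fun y => abs_sin_mul_div_le ht _))

/-- The Fourier-analytic distance entering the smoothing inequality. -/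
def fourierGap (μ ν : Measure ℝ) (T : ℝ) : ENNReal :=
  ∫⁻ t in Ioi (0 : ℝ), ENNReal.ofReal (‖charFun μ (T * t) - charFun ν (T * t)‖ / t * Real.exp (-t))

/-- The constants `π/2` cancel in the difference of the two smoothed distribution functions, leaving
sine integrals, which are imaginary parts of rotated characteristic functions. -/
lemma abs_integral_real_Iic_sub_le (μ ν : Measure ℝ) [IsProbabilityMeasure μ]
    [IsProbabilityMeasure ν] (hμ : Integrable id μ) (hν : Integrable id ν) {T : ℝ} (hT : 0 < T)
    (x : ℝ) :
    ENNReal.ofReal |∫ s, (μ.real (Iic (x - s / T)) - ν.real (Iic (x - s / T))) * (1 + s ^ 2)⁻¹| ≤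
      fourierGap μ ν T := by
  have h1 : ∫ s, (μ.real (Iic (x - s / T)) - ν.real (Iic (x - s / T))) * (1 + s ^ 2)⁻¹ =
      ∫ t in Ioi (0 : ℝ), ((∫ y, Real.sin (t * (T * (x - y))) ∂μ) -
        (∫ y, Real.sin (t * (T * (x - y))) ∂ν)) / t * Real.exp (-t) := by
    simp_rw [sub_mul, sub_div]
    rw [integral_sub (integrable_real_Iic_mul μ T x) (integrable_real_Iic_mul ν T x),
      ← integral_arctan_add_pi_div_two μ hT, ← integral_arctan_add_pi_div_two ν hT,
      integral_add (integrable_arctan μ T x) (integrable_const _),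
      integral_add (integrable_arctan ν T x) (integrable_const _),
      integral_arctan_eq μ hμ, integral_arctan_eq ν hν]
    simp_rw [sub_mul]
    rw [integral_sub (integrableOn_integral_sin μ hμ T x) (integrableOn_integral_sin ν hν T x)]
    simp
  rw [h1, ← Real.norm_eq_abs, ofReal_norm]
  refine (enorm_integral_le_lintegral_enorm _).trans ?_
  refine setLIntegral_mono' measurableSet_Ioi fun t ht => ?_
  rw [← ofReal_norm]
  refine ENNReal.ofReal_le_ofReal ?_
  rw [Real.norm_eq_abs, abs_mul, Real.abs_exp, abs_div, abs_of_pos (show 0 < t from ht)]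
  have h2 := abs_integral_sin_sub_le μ ν (T * t) x
  have h3 : ∀ y, t * (T * (x - y)) = T * t * (x - y) := fun y => by ring
  simp_rw [h3]
  have : 0 < t := ht
  gcongr

lemma integral_Icc_inv_one_add_sq :
    ∫ s in Icc (-√3 : ℝ) (√3), (1 + s ^ 2)⁻¹ = 2 * Real.pi / 3 := by
  rw [integral_Icc_eq_integral_Ioc, ← intervalIntegral.integral_of_le
    (by linarith [Real.sqrt_nonneg 3]), integral_inv_one_add_sq, Real.arctan_neg,
    Real.arctan_sqrt_three]
  ring

lemma integral_compl_Icc_inv_one_add_sq :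
    ∫ s in (Icc (-√3 : ℝ) (√3))ᶜ, (1 + s ^ 2)⁻¹ = Real.pi / 3 := by
  have := integral_add_compl (measurableSet_Icc (a := (-√3 : ℝ)) (b := √3))
    integrable_inv_one_add_sq
  rw [integral_Icc_inv_one_add_sq, integral_univ_inv_one_add_sq] at this
  linarith

/-- The window `[-√3, √3]` carries two thirds of the mass `π` of the kernel, so a lower bound there
outweighs the trivial bound `-Δ` on the remaining third. -/
lemma bound_of_le_near {D : ℝ → ℝ} {Δ d x A : ℝ} {T : ℝ}
    (hint : Integrable fun s => D (x - s / T) * (1 + s ^ 2)⁻¹)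
    (hnear : ∀ s ∈ Icc (-√3 : ℝ) (√3), d ≤ D (x - s / T)) (hall : ∀ y, -Δ ≤ D y)
    (hA : ∫ s, D (x - s / T) * (1 + s ^ 2)⁻¹ ≤ A) :
    d * (2 * Real.pi / 3) ≤ A + Δ * (Real.pi / 3) := by
  have hi := integrable_inv_one_add_sq
  rw [← integral_add_compl (measurableSet_Icc (a := (-√3 : ℝ)) (b := √3)) hint] at hA
  have h1 : d * (2 * Real.pi / 3) ≤ ∫ s in Icc (-√3 : ℝ) (√3), D (x - s / T) * (1 + s ^ 2)⁻¹ := by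
    rw [← integral_Icc_inv_one_add_sq, ← integral_const_mul]
    refine setIntegral_mono_on (hi.const_mul d).integrableOn hint.integrableOn measurableSet_Icc
      fun s hs => ?_
    exact mul_le_mul_of_nonneg_right (hnear s hs) (by positivity)
  have h2 : -Δ * (Real.pi / 3) ≤
      ∫ s in (Icc (-√3 : ℝ) (√3))ᶜ, D (x - s / T) * (1 + s ^ 2)⁻¹ := by
    rw [← integral_compl_Icc_inv_one_add_sq, ← integral_const_mul]
    refine setIntegral_mono_on (hi.const_mul _).integrableOn hint.integrableOn
      measurableSet_Icc.compl fun s hs => ?_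
    exact mul_le_mul_of_nonneg_right (hall _) (by positivity)
  linarith

lemma bddAbove_range_abs_cdf_sub (μ ν : Measure ℝ) :
    BddAbove (range fun x => |cdf μ x - cdf ν x|) := by
  refine ⟨1, ?_⟩
  rintro _ ⟨x, rfl⟩
  dsimp only
  rw [abs_le]
  constructor <;> linarith [cdf_nonneg μ x, cdf_le_one μ x, cdf_nonneg ν x, cdf_le_one ν x]

lemma kolmogorovDist_cdf_nonneg (F G : ℝ → ℝ) : 0 ≤ kolmogorovDist F G :=
  Real.iSup_nonneg fun _ => abs_nonneg _

lemma abs_cdf_sub_le_kolmogorovDist (μ ν : Measure ℝ) (x : ℝ) :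
    |cdf μ x - cdf ν x| ≤ kolmogorovDist (cdf μ) (cdf ν) :=
  le_ciSup (bddAbove_range_abs_cdf_sub μ ν) x

/-- A smoothing inequality for the Kolmogorov distance, with the Cauchy kernel. -/
lemma kolmogorovDist_le_fourierGap (μ ν : Measure ℝ) [IsProbabilityMeasure μ]
    [IsProbabilityMeasure ν] (hμ : Integrable id μ) (hν : Integrable id ν) {T : ℝ} (hT : 0 < T)
    (hL : ∀ x y, x ≤ y → cdf ν y - cdf ν x ≤ y - x) :
    ENNReal.ofReal (kolmogorovDist (cdf μ) (cdf ν)) ≤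
      fourierGap μ ν T + ENNReal.ofReal (8 / T) := by
  -- The gap is a lower integral, so its finiteness need not be proved: the infinite case is
  -- trivial.
  rcases eq_or_ne (fourierGap μ ν T) ⊤ with h | h
  · simp [h]
  set A := (fourierGap μ ν T).toReal with hA
  have hA0 : 0 ≤ A := ENNReal.toReal_nonneg
  have hbound : ∀ x, |∫ s, (cdf μ (x - s / T) - cdf ν (x - s / T)) * (1 + s ^ 2)⁻¹| ≤ A := by
    intro x
    have := abs_integral_real_Iic_sub_le μ ν hμ hν hT x
    rw [← ENNReal.ofReal_toReal h, ENNReal.ofReal_le_ofReal_iff hA0] at this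
    simpa only [cdf_eq_real] using this
  rw [← ENNReal.ofReal_toReal h, ← ENNReal.ofReal_add hA0 (by positivity)]
  refine ENNReal.ofReal_le_ofReal ?_
  set Δ := kolmogorovDist (cdf μ) (cdf ν) with hΔ
  have hint : ∀ x, Integrable fun s => (cdf μ (x - s / T) - cdf ν (x - s / T)) * (1 + s ^ 2)⁻¹ := by
    intro x
    simp_rw [sub_mul, cdf_eq_real]
    exact (integrable_real_Iic_mul μ T x).sub (integrable_real_Iic_mul ν T x)
  have hall : ∀ y, |cdf μ y - cdf ν y| ≤ Δ := abs_cdf_sub_le_kolmogorovDist μ ν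
  have hs3 : √3 ≤ 2 := by
    rw [Real.sqrt_le_left (by norm_num)]; norm_num
  have hpt : ∀ x0, |cdf μ x0 - cdf ν x0| * (2 * Real.pi / 3) ≤
      A + Δ * (Real.pi / 3) + (4 / T) * (2 * Real.pi / 3) := by
    intro x0
    rcases le_total 0 (cdf μ x0 - cdf ν x0) with hx | hx
    · rw [abs_of_nonneg hx]
      -- The window is shifted to lie to the right of `x0`, where `cdf μ` can only grow. Meanwhile
      -- `cdf ν` grows by at most the window's length `2√3/T ≤ 4/T`. For a negative difference the
      -- window is placed to the left.
      have := bound_of_le_near (D := fun y => cdf μ y - cdf ν y) (Δ := Δ) (T := T)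
        (d := cdf μ x0 - cdf ν x0 - 4 / T) (x := x0 + √3 / T) (A := A) (hint _) ?_ ?_ ?_
      · linarith
      · intro s hs
        have h1 : x0 ≤ x0 + √3 / T - s / T := by
          have : s / T ≤ √3 / T := by gcongr; exact hs.2
          linarith
        have h2 := monotone_cdf μ h1
        have h3 := hL _ _ h1
        have h4 : √3 / T - s / T ≤ 4 / T := by
          rw [← sub_div]; gcongr; linarith [hs.1]
        linarith
      · exact fun y => (abs_le.1 (hall y)).1
      · exact (abs_le.1 (hbound _)).2
    · rw [abs_of_nonpos hx]
      have := bound_of_le_near (D := fun y => -(cdf μ y - cdf ν y)) (Δ := Δ) (T := T)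
        (d := -(cdf μ x0 - cdf ν x0) - 4 / T) (x := x0 - √3 / T) (A := A) ?_ ?_ ?_ ?_
      · linarith
      · simp only [neg_mul]
        exact (hint _).neg
      · intro s hs
        have h1 : x0 - √3 / T - s / T ≤ x0 := by
          have : -√3 / T ≤ s / T := by gcongr; exact hs.1
          rw [neg_div] at this
          linarith
        have h2 := monotone_cdf μ h1
        have h3 := hL _ _ h1
        have h4 : √3 / T + s / T ≤ 4 / T := by
          rw [← add_div]; gcongr; linarith [hs.2]
        linarith
      · intro y
        linarith [(abs_le.1 (hall y)).2]
      · simp only [neg_mul, integral_neg]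
        linarith [(abs_le.1 (hbound (x0 - √3 / T))).1]
  have hsup : Δ * (2 * Real.pi / 3) ≤ A + Δ * (Real.pi / 3) + (4 / T) * (2 * Real.pi / 3) := by
    have hp : 0 < 2 * Real.pi / 3 := by positivity
    rw [← le_div_iff₀ hp]
    exact ciSup_le fun x => (le_div_iff₀ hp).2 (hpt x)
  -- Moving `Δ π/3` to the left gives `Δ ≤ (3/π) A + 8/T`, and `3/π < 1`.
  have h3 := Real.pi_gt_three
  have h8 : (8 / T) = 2 * (4 / T) := by ring
  rw [h8]
  by_contra hc
  push Not at hc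
  have : (A + 2 * (4 / T)) * (Real.pi / 3) < Δ * (Real.pi / 3) := by gcongr
  nlinarith

/-! ### Mean square estimates for the Gaussian-averaged characteristic function -/

section

lemma exp_sub_one_sub_id_le (x : ℝ) : Real.exp x - 1 - x ≤ x ^ 2 * (1 + Real.exp x) := by
  have h1 := Real.add_one_le_exp x
  have h2 := Real.add_one_le_exp (-x)
  have h3 : Real.exp x * Real.exp (-x) = 1 := by rw [← Real.exp_add]; simp
  have h0 := Real.exp_pos x
  have h4 : Real.exp x * (1 - x) ≤ 1 := by nlinarith
  rcases le_total 0 x with h | h <;> nlinarith [sq_nonneg x, mul_nonneg (sq_nonneg x) h0.le]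

lemma abs_exp_neg_sub_exp_neg_le {a b m : ℝ} (ha : m ≤ a) (hb : m ≤ b) :
    |Real.exp (-a) - Real.exp (-b)| ≤ Real.exp (-m) * |a - b| := by
  wlog h : a ≤ b generalizing a b
  · rw [abs_sub_comm, abs_sub_comm a]
    exact this hb ha (le_of_not_ge h)
  have h1 : Real.exp (-b) ≤ Real.exp (-a) := Real.exp_le_exp.2 (by linarith)
  rw [abs_of_nonneg (by linarith), abs_of_nonpos (by linarith)]
  have h2 : Real.exp (-b) = Real.exp (-a) * Real.exp (a - b) := by
    rw [← Real.exp_add]; ring_nf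
  have h3 := Real.add_one_le_exp (a - b)
  have h4 : Real.exp (-a) ≤ Real.exp (-m) := Real.exp_le_exp.2 (by linarith)
  calc Real.exp (-a) - Real.exp (-b) ≤ Real.exp (-a) * -(a - b) := by
        rw [h2]; nlinarith [Real.exp_pos (-a)]
    _ ≤ _ := by gcongr; linarith

lemma mul_exp_neg_le_one (s : ℝ) : s * Real.exp (-s) ≤ 1 := by
  have h := Real.add_one_le_exp s
  have h3 : Real.exp s * Real.exp (-s) = 1 := by rw [← Real.exp_add]; simp
  nlinarith [Real.exp_pos (-s)]

/-- For `s ≤ 1` the exponential is 1-Lipschitz. For `s ≥ 1` and `u ≥ 1/2` its decay gives the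
constant `s exp (-s/2) ≤ 2`, while for `u ≤ 1/2` the right side is at least `1`. -/
lemma abs_exp_neg_mul_sub_le {s u : ℝ} (hs : 0 ≤ s) (hu : 0 ≤ u) :
    |Real.exp (-(s * u)) - Real.exp (-s)| ≤ 2 * min 1 s * |u - 1| := by
  have hsu : |s * u - s| = s * |u - 1| := by
    rw [← mul_sub_one, abs_mul, abs_of_nonneg hs]
  rcases le_total s 1 with h | h
  · rw [min_eq_right h]
    have := abs_exp_neg_sub_exp_neg_le (mul_nonneg hs hu) hs
    rw [hsu] at this
    simp only [neg_zero, Real.exp_zero, one_mul] at this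
    nlinarith [mul_nonneg hs (abs_nonneg (u - 1))]
  · rw [min_eq_left h, mul_one]
    rcases le_total u (1 / 2) with h2 | h2
    · have h3 : 1 ≤ 2 * |u - 1| := by
        rw [abs_of_nonpos (by linarith)]; linarith
      refine le_trans ?_ h3
      have h4 : Real.exp (-(s * u)) ≤ 1 := Real.exp_le_one_iff.2 (by nlinarith)
      have h5 : Real.exp (-s) ≤ 1 := Real.exp_le_one_iff.2 (by linarith)
      rw [abs_le]
      constructor <;> linarith [Real.exp_pos (-(s * u)), Real.exp_pos (-s)]
    · have := abs_exp_neg_sub_exp_neg_le (a := s * u) (b := s) (m := s / 2) (by nlinarith)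
        (by linarith)
      rw [hsu] at this
      have h6 := mul_exp_neg_le_one (s / 2)
      nlinarith [mul_le_mul_of_nonneg_right h6 (abs_nonneg (u - 1))]

/-- The second order remainder of `exp (-s (u + v - 2 w))` as a function of `w` at zero. -/
def expRemainder (s u v w : ℝ) : ℝ :=
  Real.exp (-(s * (u + v - 2 * w))) - Real.exp (-(s * u)) * Real.exp (-(s * v)) * (1 + 2 * s * w)

lemma expRemainder_le (s u v w : ℝ) :
    expRemainder s u v w ≤ (2 * s * w) ^ 2 *
      (Real.exp (-(s * (u + v))) + Real.exp (-(s * (u + v - 2 * w)))) := by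
  have h := exp_sub_one_sub_id_le (2 * s * w)
  have h1 : Real.exp (-(s * u)) * Real.exp (-(s * v)) = Real.exp (-(s * (u + v))) := by
    rw [← Real.exp_add]; ring_nf
  have h2 : Real.exp (-(s * (u + v - 2 * w))) =
      Real.exp (-(s * (u + v))) * Real.exp (2 * s * w) := by
    rw [← Real.exp_add]; ring_nf
  rw [expRemainder, h1, h2]
  nlinarith [mul_le_mul_of_nonneg_left h (Real.exp_pos (-(s * (u + v)))).le]

lemma expRemainder_le_sq {s u v w : ℝ} (hs : 0 ≤ s) (huv : 0 ≤ u + v) (hw : 2 * w ≤ u + v) :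
    expRemainder s u v w ≤ 8 * s ^ 2 * w ^ 2 := by
  have h4 : Real.exp (-(s * (u + v))) ≤ 1 := Real.exp_le_one_iff.2 (by nlinarith)
  have h5 : Real.exp (-(s * (u + v - 2 * w))) ≤ 1 := Real.exp_le_one_iff.2 (by nlinarith)
  have := expRemainder_le s u v w
  nlinarith [mul_le_mul_of_nonneg_left (add_le_add h4 h5) (sq_nonneg (2 * s * w))]

/-- A bound uniform in `s`, needed for large `s`, where the factor `s²` of `expRemainder_le_sq` is
useless. Either `w` is large, or `u + v` is large enough for exponential decay to beat `s²`, or both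
`u` and `v` are far from `1`. -/
lemma expRemainder_le_of_nonneg {s u v w : ℝ} (hs : 0 ≤ s) (hu : 0 ≤ u) (hv : 0 ≤ v)
    (hw : 2 * w ≤ u + v) (hw' : -(u + v) ≤ 2 * w) :
    expRemainder s u v w ≤ 256 * w ^ 2 + 8 * (|u - 1| * |v - 1|) := by
  have hp : 0 ≤ |u - 1| * |v - 1| := by positivity
  have h1 : Real.exp (-(s * u)) * Real.exp (-(s * v)) = Real.exp (-(s * (u + v))) := by
    rw [← Real.exp_add]; ring_nf
  have h5 : Real.exp (-(s * (u + v - 2 * w))) ≤ 1 := Real.exp_le_one_iff.2 (by nlinarith)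
  have he := Real.exp_pos (-(s * (u + v)))
  rcases lt_or_ge (1 / 8) w with h | h
  · have : expRemainder s u v w ≤ 1 := by
      rw [expRemainder, h1]
      have : 0 ≤ Real.exp (-(s * (u + v))) * (1 + 2 * s * w) := by
        have : 0 ≤ s * w := by nlinarith
        apply mul_nonneg he.le; linarith
      linarith
    nlinarith
  rcases le_or_gt (1 / 2) (u + v) with h' | h'
  -- Here `u + v - 2w ≥ 1/2 - 1/4`. The constant `256` is `4 · 2 · 32`, with `s² exp (-s/4) ≤ 32`.
  · have h6 : Real.exp (-(s * (u + v))) ≤ Real.exp (-(s / 4)) :=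
      Real.exp_le_exp.2 (by nlinarith)
    have h7 : Real.exp (-(s * (u + v - 2 * w))) ≤ Real.exp (-(s / 4)) :=
      Real.exp_le_exp.2 (by nlinarith)
    have h8 : s ^ 2 * Real.exp (-(s / 4)) ≤ 32 := by
      have := Real.quadratic_le_exp_of_nonneg (x := s / 4) (by positivity)
      have h3 : Real.exp (s / 4) * Real.exp (-(s / 4)) = 1 := by rw [← Real.exp_add]; simp
      nlinarith [Real.exp_pos (-(s / 4)), mul_nonneg hs (Real.exp_pos (-(s / 4))).le]
    have := expRemainder_le s u v w
    have h9 := mul_le_mul_of_nonneg_left (add_le_add h6 h7) (sq_nonneg (2 * s * w))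
    nlinarith [mul_le_mul_of_nonneg_right h8 (sq_nonneg w)]
  · have hR : expRemainder s u v w ≤ 2 := by
      rw [expRemainder, h1]
      have h3 := mul_exp_neg_le_one (s * (u + v))
      have h10 : -(s * (u + v)) ≤ 2 * s * w := by nlinarith
      nlinarith [mul_le_mul_of_nonneg_left h10 he.le]
    -- The product of the two deviations is at least `1/4`, so `8` times it covers the bound `2`.
    have h11 : 1 / 2 ≤ |u - 1| := by rw [abs_of_nonpos (by linarith)]; linarith
    have h12 : 1 / 2 ≤ |v - 1| := by rw [abs_of_nonpos (by linarith)]; linarith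
    nlinarith [mul_le_mul h11 h12 (by norm_num) (abs_nonneg _), sq_nonneg w]

variable {E : Type*} [NormedAddCommGroup E] [InnerProductSpace ℝ E] [FiniteDimensional ℝ E]
  [MeasurableSpace E] [BorelSpace E]

/-- A law on `E` with identity second moment operator, where `n` is the dimension of `E`. -/
structure IsotropicLaw (μ : Measure E) (n : ℝ) : Prop where
  pos : 0 < n
  integrable_sq : Integrable (fun x => ‖x‖ ^ 2) μ
  integral_sq : ∫ x, ‖x‖ ^ 2 ∂μ = n
  integral_inner_sq : ∀ a : E, ∫ x, ⟪x, a⟫ ^ 2 ∂μ = ‖a‖ ^ 2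

/-- The first absolute central moment of `|X|² / n`. -/
def normDeviation (μ : Measure E) (n : ℝ) : ℝ := ∫ x, |‖x‖ ^ 2 / n - 1| ∂μ

namespace IsotropicLaw

variable {μ : Measure E} [IsProbabilityMeasure μ] {n : ℝ}

lemma integrable_norm (h : IsotropicLaw μ n) : Integrable (fun x : E => ‖x‖) μ := by
  refine Integrable.mono' (h.integrable_sq.add (integrable_const 1))
    (Measurable.aestronglyMeasurable (by fun_prop)) (Eventually.of_forall fun x => ?_)
  simp only [norm_norm, Pi.add_apply]
  nlinarith [sq_nonneg (‖x‖ - 1)]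

lemma integrable_deviation (h : IsotropicLaw μ n) :
    Integrable (fun x : E => |‖x‖ ^ 2 / n - 1|) μ :=
  ((h.integrable_sq.div_const n).sub (integrable_const 1)).abs

lemma integrable_inner_sq (h : IsotropicLaw μ n) (a : E) :
    Integrable (fun x : E => ⟪x, a⟫ ^ 2) μ := by
  refine Integrable.mono' (h.integrable_sq.mul_const (‖a‖ ^ 2))
    (Measurable.aestronglyMeasurable (by fun_prop)) (Eventually.of_forall fun x => ?_)
  rw [Real.norm_eq_abs, abs_of_nonneg (sq_nonneg _), ← mul_pow, ← sq_abs]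
  gcongr
  exact abs_real_inner_le_norm x a

/-- Bessel's inequality for the coordinates of an isotropic vector. -/
lemma norm_integral_smul_sq_le (h : IsotropicLaw μ n) {b : E → ℝ}
    (hb : Integrable (fun x => b x ^ 2) μ) (hbx : Integrable (fun x => b x • x) μ) :
    ‖∫ x, b x • x ∂μ‖ ^ 2 ≤ ∫ x, b x ^ 2 ∂μ := by
  set V := ∫ x, b x • x ∂μ with hV
  have h1 : ‖V‖ ^ 2 = ∫ x, b x * ⟪x, V⟫ ∂μ := by
    rw [← real_inner_self_eq_norm_sq]
    conv_lhs => rw [hV, real_inner_comm, ← integral_inner hbx]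
    congr 1 with x
    rw [real_inner_smul_right, real_inner_comm]
  -- By isotropy the second square integrates to `‖V‖²`, half of which is absorbed on the left.
  have h2 : ∫ x, b x * ⟪x, V⟫ ∂μ ≤ ∫ x, (b x ^ 2 + ⟪x, V⟫ ^ 2) / 2 ∂μ := by
    refine integral_mono ?_ ((hb.add (h.integrable_inner_sq V)).div_const 2) fun x => ?_
    · have := hbx.inner_const (𝕜 := ℝ) V
      simpa only [real_inner_smul_left] using this
    · nlinarith [sq_nonneg (b x - ⟪x, V⟫)]
  rw [integral_div, integral_add hb (h.integrable_inner_sq V), h.integral_inner_sq] at h2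
  linarith

lemma integral_prod_inner_sq (h : IsotropicLaw μ n) :
    Integrable (fun p : E × E => ⟪p.1, p.2⟫ ^ 2) (μ.prod μ) ∧
      ∫ p : E × E, ⟪p.1, p.2⟫ ^ 2 ∂(μ.prod μ) = n := by
  have hi : Integrable (fun p : E × E => ⟪p.1, p.2⟫ ^ 2) (μ.prod μ) := by
    refine Integrable.mono' (h.integrable_sq.mul_prod h.integrable_sq)
      (Measurable.aestronglyMeasurable (by fun_prop)) (Eventually.of_forall fun p => ?_)
    rw [Real.norm_eq_abs, abs_of_nonneg (sq_nonneg _), ← mul_pow, ← sq_abs]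
    gcongr
    exact abs_real_inner_le_norm _ _
  refine ⟨hi, ?_⟩
  rw [integral_prod_symm _ hi]
  simp only [h.integral_inner_sq, h.integral_sq]

/-- The weight `exp (-s |x|² / n)`. -/
def weight (n s : ℝ) (x : E) : ℝ := Real.exp (-(s * (‖x‖ ^ 2 / n)))

lemma measurable_weight (n s : ℝ) : Measurable (weight n s : E → ℝ) := by
  unfold weight; fun_prop

lemma weight_le_one (h : IsotropicLaw μ n) {s : ℝ} (hs : 0 ≤ s) (x : E) : weight n s x ≤ 1 := by
  have := h.pos
  exact Real.exp_le_one_iff.2 (neg_nonpos.2 (by positivity))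

lemma weight_pos (n s : ℝ) (x : E) : 0 < weight n s x := Real.exp_pos _

lemma integrable_weight (h : IsotropicLaw μ n) {s : ℝ} (hs : 0 ≤ s) :
    Integrable (weight n s) μ :=
  Integrable.of_bound (measurable_weight n s).aestronglyMeasurable 1
    (Eventually.of_forall fun x => by
      rw [Real.norm_eq_abs, abs_of_pos (weight_pos _ _ _)]; exact h.weight_le_one hs x)

lemma abs_integral_weight_sub_le (h : IsotropicLaw μ n) {s : ℝ} (hs : 0 ≤ s) :
    |∫ x, weight n s x ∂μ - Real.exp (-s)| ≤ 2 * min 1 s * normDeviation μ n := by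
  have hn := h.pos
  have h1 : ∫ x, weight n s x ∂μ - Real.exp (-s) = ∫ x, (weight n s x - Real.exp (-s)) ∂μ := by
    rw [integral_sub (h.integrable_weight hs) (integrable_const _)]; simp
  rw [h1, normDeviation, ← integral_const_mul]
  refine abs_integral_le_integral_abs.trans (integral_mono
    ((h.integrable_weight hs).sub (integrable_const _)).abs
    (h.integrable_deviation.const_mul _) fun x => ?_)
  exact abs_exp_neg_mul_sub_le hs (by positivity)

lemma integrable_smul_id (h : IsotropicLaw μ n) {b : E → ℝ} (hb : Measurable b)
    (hb1 : ∀ x, |b x| ≤ 1) : Integrable (fun x => b x • x) μ := by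
  refine Integrable.mono' h.integrable_norm
    (Measurable.aestronglyMeasurable (by fun_prop)) (Eventually.of_forall fun x => ?_)
  rw [norm_smul]
  exact mul_le_of_le_one_left (norm_nonneg _) (hb1 x)

lemma integrable_sq_of_le_one {b : E → ℝ} (hb : Measurable b)
    (hb1 : ∀ x, |b x| ≤ 1) : Integrable (fun x => b x ^ 2) μ := by
  refine Integrable.of_bound (Measurable.aestronglyMeasurable (by fun_prop)) 1
    (Eventually.of_forall fun x => ?_)
  rw [Real.norm_eq_abs, abs_of_nonneg (sq_nonneg _), ← sq_abs]
  exact pow_le_one₀ (abs_nonneg _) (hb1 x)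

/-- Controls the term linear in `⟨X, Y⟩`. Bessel's inequality suffices for `s ≤ 1`. For large `s`
the factor `s` must be absorbed by the weight, which is small only where `‖x‖² / n` is not small. -/
lemma norm_integral_weight_smul_sq_le (h : IsotropicLaw μ n) {s : ℝ} (hs : 0 ≤ s) :
    2 * s * (‖∫ x, weight n s x • x ∂μ‖ ^ 2 / n) ≤
      min 1 s * (16 * normDeviation μ n ^ 2 + 4 * (1 / n)) := by
  have hn := h.pos
  have hw1 : ∀ x : E, |weight n s x| ≤ 1 := fun x => by
    rw [abs_of_pos (weight_pos _ _ _)]; exact h.weight_le_one hs x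
  have hwm : Measurable (weight n s : E → ℝ) := measurable_weight n s
  rcases le_total s 1 with hs1 | hs1
  · rw [min_eq_right hs1]
    have h1 := h.norm_integral_smul_sq_le (integrable_sq_of_le_one (μ := μ) hwm hw1)
      (h.integrable_smul_id hwm hw1)
    have h2 : ∫ x, weight n s x ^ 2 ∂μ ≤ 1 := by
      have := integral_mono (integrable_sq_of_le_one (μ := μ) hwm hw1) (integrable_const (1 : ℝ))
        (fun x => pow_le_one₀ (weight_pos n s x).le (h.weight_le_one hs x))
      simpa using this
    have h3 : ‖∫ x, weight n s x • x ∂μ‖ ^ 2 / n ≤ 1 / n := by gcongr; linarith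
    have h4 : 0 ≤ 1 / n := by positivity
    nlinarith [sq_nonneg (normDeviation μ n), mul_nonneg hs (sq_nonneg (normDeviation μ n)),
      mul_nonneg hs h4, mul_le_mul_of_nonneg_left h3 hs]
  · rw [min_eq_left hs1, one_mul]
    -- On `S` the deviation exceeds `1/2`, and `s ‖x‖² weight ≤ n` makes the triangle inequality
    -- enough. Off `S` the squared weight is at most `exp (-s)`, and Bessel's inequality applies.
    set S : Set E := {x | ‖x‖ ^ 2 / n < 1 / 2} with hS
    have hSm : MeasurableSet S := measurableSet_lt (by fun_prop) (by fun_prop)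
    set a : E → ℝ := S.indicator (weight n s) with ha
    set b : E → ℝ := Sᶜ.indicator (weight n s) with hb
    have ham : Measurable a := hwm.indicator hSm
    have hbm : Measurable b := hwm.indicator hSm.compl
    have ha1 : ∀ x, |a x| ≤ 1 := fun x => by
      by_cases hx : x ∈ S <;> simp [ha, hx, hw1]
    have hb1 : ∀ x, |b x| ≤ 1 := fun x => by
      by_cases hx : x ∈ S <;> simp [hb, hx, hw1]
    have hab : ∫ x, weight n s x • x ∂μ = ∫ x, a x • x ∂μ + ∫ x, b x • x ∂μ := by
      rw [← integral_add (h.integrable_smul_id ham ha1) (h.integrable_smul_id hbm hb1)]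
      congr 1 with x
      rw [← add_smul]
      congr 1
      exact (congrFun (indicator_self_add_compl S (weight n s)) x).symm
    have hA : Real.sqrt s * ‖∫ x, a x • x ∂μ‖ ≤ Real.sqrt n * (2 * normDeviation μ n) := by
      have h1 : Real.sqrt s * ‖∫ x, a x • x ∂μ‖ ≤ ∫ x, Real.sqrt s * ‖a x • x‖ ∂μ := by
        rw [integral_const_mul]
        gcongr
        exact norm_integral_le_integral_norm _
      refine h1.trans ?_
      rw [normDeviation, ← integral_const_mul, ← integral_const_mul]
      refine integral_mono ((h.integrable_smul_id ham ha1).norm.const_mul _)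
        ((h.integrable_deviation.const_mul _).const_mul _) fun x => ?_
      by_cases hx : x ∈ S
      · have hx' : ‖x‖ ^ 2 / n < 1 / 2 := hx
        have h5 : 1 ≤ 2 * |‖x‖ ^ 2 / n - 1| := by
          rw [abs_of_nonpos (by linarith)]; linarith
        refine le_trans ?_ (le_mul_of_one_le_right (Real.sqrt_nonneg n) h5)
        simp only [ha, indicator_of_mem hx, norm_smul, Real.norm_eq_abs,
          abs_of_pos (weight_pos n s x)]
        apply Real.le_sqrt_of_sq_le
        rw [mul_pow, mul_pow, Real.sq_sqrt hs]
        have h6 := mul_exp_neg_le_one (s * (‖x‖ ^ 2 / n))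
        have h7 := h.weight_le_one hs x
        have h8 := weight_pos n s x
        have h9 : s * ‖x‖ ^ 2 * weight n s x ≤ n := by
          have : s * (‖x‖ ^ 2 / n) * weight n s x * n ≤ 1 * n := by
            gcongr; exact h6
          have h10 : s * (‖x‖ ^ 2 / n) * weight n s x * n = s * ‖x‖ ^ 2 * weight n s x := by
            field_simp
          linarith
        calc s * (weight n s x ^ 2 * ‖x‖ ^ 2) = (s * ‖x‖ ^ 2 * weight n s x) * weight n s x := by
              ring
          _ ≤ (s * ‖x‖ ^ 2 * weight n s x) * 1 := by gcongr
          _ ≤ n := by linarith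
      · simp only [ha, indicator_of_notMem hx, zero_smul, norm_zero, mul_zero]
        positivity
    have hA2 : s * ‖∫ x, a x • x ∂μ‖ ^ 2 ≤ n * (4 * normDeviation μ n ^ 2) := by
      have := pow_le_pow_left₀ (by positivity) hA 2
      rw [mul_pow, mul_pow, Real.sq_sqrt hs, Real.sq_sqrt hn.le] at this
      linarith
    have hB : ‖∫ x, b x • x ∂μ‖ ^ 2 ≤ Real.exp (-s) := by
      refine (h.norm_integral_smul_sq_le (integrable_sq_of_le_one hbm hb1)
        (h.integrable_smul_id hbm hb1)).trans ?_
      have := integral_mono (integrable_sq_of_le_one (μ := μ) hbm hb1)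
        (integrable_const (Real.exp (-s))) (fun x => ?_)
      · simpa using this
      · by_cases hx : x ∈ S
        · simp [hb, hx, Real.exp_nonneg]
        · have hx' : 1 / 2 ≤ ‖x‖ ^ 2 / n := not_lt.1 hx
          simp only [hb, indicator_of_mem (show x ∈ Sᶜ from hx), weight]
          rw [← Real.exp_nat_mul]
          refine Real.exp_le_exp.2 ?_
          push_cast
          nlinarith
    have hB2 : s * ‖∫ x, b x • x ∂μ‖ ^ 2 ≤ 1 :=
      (mul_le_mul_of_nonneg_left hB hs).trans (mul_exp_neg_le_one s)
    have hV : ‖∫ x, weight n s x • x ∂μ‖ ^ 2 ≤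
        2 * ‖∫ x, a x • x ∂μ‖ ^ 2 + 2 * ‖∫ x, b x • x ∂μ‖ ^ 2 := by
      rw [hab]
      have := norm_add_le (∫ x, a x • x ∂μ) (∫ x, b x • x ∂μ)
      nlinarith [sq_nonneg (‖∫ x, a x • x ∂μ‖ - ‖∫ x, b x • x ∂μ‖),
        norm_nonneg (∫ x, a x • x ∂μ + ∫ x, b x • x ∂μ)]
    have : 2 * s * (‖∫ x, weight n s x • x ∂μ‖ ^ 2 / n) =
      2 * (s * ‖∫ x, weight n s x • x ∂μ‖ ^ 2) / n := by ring
    rw [this, div_le_iff₀ hn]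
    have h12 : (16 * normDeviation μ n ^ 2 + 4 * (1 / n)) * n =
      16 * (n * normDeviation μ n ^ 2) + 4 := by field_simp
    rw [h12]
    nlinarith [mul_le_mul_of_nonneg_left hV hs]

lemma integrable_prod_weight (h : IsotropicLaw μ n) {s : ℝ} (hs : 0 ≤ s) :
    Integrable (fun p : E × E => Real.exp (-(s * (‖p.1 - p.2‖ ^ 2 / n)))) (μ.prod μ) := by
  have hn := h.pos
  refine Integrable.of_bound (Measurable.aestronglyMeasurable (by fun_prop)) 1
    (Eventually.of_forall fun p => ?_)
  rw [Real.norm_eq_abs, Real.abs_exp]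
  exact Real.exp_le_one_iff.2 (neg_nonpos.2 (by positivity))

/-- The mean square deviation of the characteristic function of a Gaussian projection of an
isotropic vector. -/
lemma integral_prod_weight_sub_le (h : IsotropicLaw μ n) {s : ℝ} (hs : 0 ≤ s) :
    ∫ p : E × E, Real.exp (-(s * (‖p.1 - p.2‖ ^ 2 / n))) ∂(μ.prod μ) -
        2 * Real.exp (-s) * ∫ x, weight n s x ∂μ + Real.exp (-s) ^ 2 ≤
      300 * (1 / n + normDeviation μ n ^ 2) * min 1 s := by
  have hn := h.pos
  set δ := normDeviation μ n
  have hw1 : ∀ x : E, |weight n s x| ≤ 1 := fun x => by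
    rw [abs_of_pos (weight_pos _ _ _)]; exact h.weight_le_one hs x
  have hwm : Measurable (weight n s : E → ℝ) := measurable_weight n s
  have hVi := h.integrable_smul_id hwm hw1
  have hi1 : Integrable (fun p : E × E => weight n s p.1 * weight n s p.2) (μ.prod μ) :=
    (h.integrable_weight hs).mul_prod (h.integrable_weight hs)
  have hi2 : Integrable (fun p : E × E => ⟪weight n s p.1 • p.1, weight n s p.2 • p.2⟫)
      (μ.prod μ) := by
    refine Integrable.mono' (hVi.norm.mul_prod hVi.norm)
      (Measurable.aestronglyMeasurable (by fun_prop)) (Eventually.of_forall fun p => ?_)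
    rw [Real.norm_eq_abs]
    exact abs_real_inner_le_norm _ _
  have hI2 : ∫ p : E × E, ⟪weight n s p.1 • p.1, weight n s p.2 • p.2⟫ ∂(μ.prod μ) =
      ‖∫ x, weight n s x • x ∂μ‖ ^ 2 := by
    rw [integral_prod _ hi2]
    simp only
    have : ∀ x : E, ∫ y, ⟪weight n s x • x, weight n s y • y⟫ ∂μ =
        ⟪∫ y, weight n s y • y ∂μ, weight n s x • x⟫ := fun x => by
      rw [integral_inner hVi, real_inner_comm]
    simp_rw [this]
    rw [integral_inner hVi, real_inner_self_eq_norm_sq]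
  set R : E × E → ℝ := fun p =>
    expRemainder s (‖p.1‖ ^ 2 / n) (‖p.2‖ ^ 2 / n) (⟪p.1, p.2⟫ / n) with hR
  -- After integration the product term completes the square `(E weight - exp (-s))²`, and the
  -- linear term becomes the squared norm of `E[weight · X]`.
  have hdec : ∀ p : E × E, Real.exp (-(s * (‖p.1 - p.2‖ ^ 2 / n))) =
      weight n s p.1 * weight n s p.2 +
        (2 * s / n) * ⟪weight n s p.1 • p.1, weight n s p.2 • p.2⟫ + R p := by
    intro p
    have h1 : ‖p.1 - p.2‖ ^ 2 / n =
        ‖p.1‖ ^ 2 / n + ‖p.2‖ ^ 2 / n - 2 * (⟪p.1, p.2⟫ / n) := by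
      rw [norm_sub_sq_real]; ring
    rw [h1, hR, real_inner_smul_left, real_inner_smul_right]
    simp only [expRemainder, weight]
    ring
  have hRi : Integrable R (μ.prod μ) := by
    have : R = fun p => Real.exp (-(s * (‖p.1 - p.2‖ ^ 2 / n))) -
      (weight n s p.1 * weight n s p.2 +
        (2 * s / n) * ⟪weight n s p.1 • p.1, weight n s p.2 • p.2⟫) := by
      ext p; rw [hdec]; ring
    rw [this]
    exact (h.integrable_prod_weight hs).sub (hi1.add (hi2.const_mul _))
  have hRpt : ∀ p : E × E, R p ≤ min 1 s *
      (256 / n ^ 2 * ⟪p.1, p.2⟫ ^ 2 + 8 * (|‖p.1‖ ^ 2 / n - 1| * |‖p.2‖ ^ 2 / n - 1|)) := by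
    intro p
    have hinn := abs_le.1 (abs_real_inner_le_norm p.1 p.2)
    have hb1 : 2 * (⟪p.1, p.2⟫ / n) ≤ ‖p.1‖ ^ 2 / n + ‖p.2‖ ^ 2 / n := by
      rw [← add_div, ← mul_div_assoc]
      gcongr
      nlinarith [sq_nonneg (‖p.1‖ - ‖p.2‖)]
    have hb2 : -(‖p.1‖ ^ 2 / n + ‖p.2‖ ^ 2 / n) ≤ 2 * (⟪p.1, p.2⟫ / n) := by
      rw [← add_div, ← mul_div_assoc, ← neg_div]
      gcongr
      nlinarith [sq_nonneg (‖p.1‖ - ‖p.2‖)]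
    have hq : 256 / n ^ 2 * ⟪p.1, p.2⟫ ^ 2 = 256 * (⟪p.1, p.2⟫ / n) ^ 2 := by
      rw [div_pow]; ring
    rw [hq]
    rcases le_total s 1 with hs1 | hs1
    · rw [min_eq_right hs1]
      have := expRemainder_le_sq (v := ‖p.2‖ ^ 2 / n) hs (by positivity) hb1
      have h3 : 0 ≤ |‖p.1‖ ^ 2 / n - 1| * |‖p.2‖ ^ 2 / n - 1| := by positivity
      have h4 : s ^ 2 ≤ s := by nlinarith
      have h5 := sq_nonneg (⟪p.1, p.2⟫ / n)
      calc R p ≤ 8 * s ^ 2 * (⟪p.1, p.2⟫ / n) ^ 2 := this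
        _ ≤ 256 * s * (⟪p.1, p.2⟫ / n) ^ 2 := by
            apply mul_le_mul_of_nonneg_right _ h5; linarith
        _ ≤ _ := by nlinarith [mul_nonneg hs h3]
    · rw [min_eq_left hs1, one_mul]
      exact expRemainder_le_of_nonneg hs (by positivity) (by positivity) hb1 hb2
  have hdd : Integrable (fun p : E × E => |‖p.1‖ ^ 2 / n - 1| * |‖p.2‖ ^ 2 / n - 1|)
      (μ.prod μ) := h.integrable_deviation.mul_prod h.integrable_deviation
  have hRint : ∫ p, R p ∂(μ.prod μ) ≤ min 1 s * (256 * (1 / n) + 8 * δ ^ 2) := by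
    refine (integral_mono hRi (((h.integral_prod_inner_sq.1.const_mul _).add
      (hdd.const_mul 8)).const_mul _) hRpt).trans (le_of_eq ?_)
    rw [integral_const_mul]
    congr 1
    simp only [Pi.add_apply]
    rw [integral_add (h.integral_prod_inner_sq.1.const_mul _) (hdd.const_mul 8),
      integral_const_mul, integral_const_mul, h.integral_prod_inner_sq.2,
      integral_prod_mul (f := fun x : E => |‖x‖ ^ 2 / n - 1|)
        (g := fun x : E => |‖x‖ ^ 2 / n - 1|)]
    change _ + 8 * (δ * δ) = _
    field_simp
  have hI1 : ∫ p : E × E, weight n s p.1 * weight n s p.2 ∂(μ.prod μ) =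
      (∫ x, weight n s x ∂μ) ^ 2 := by
    rw [integral_prod_mul (f := (weight n s : E → ℝ)) (g := (weight n s : E → ℝ)), sq]
  simp_rw [hdec]
  have hi12 : Integrable (fun p : E × E => weight n s p.1 * weight n s p.2 +
      2 * s / n * ⟪weight n s p.1 • p.1, weight n s p.2 • p.2⟫) (μ.prod μ) :=
    hi1.add (hi2.const_mul _)
  rw [integral_add hi12 hRi, integral_add hi1 (hi2.const_mul _),
    integral_const_mul, hI1, hI2]
  have hV := h.norm_integral_weight_smul_sq_le hs
  have hV' : 2 * s / n * ‖∫ x, weight n s x • x ∂μ‖ ^ 2 =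
    2 * s * (‖∫ x, weight n s x • x ∂μ‖ ^ 2 / n) := by ring
  rw [hV']
  have hm := h.abs_integral_weight_sub_le hs
  have hδ : 0 ≤ δ := integral_nonneg fun x => abs_nonneg _
  have hmin0 : 0 ≤ min 1 s := le_min zero_le_one hs
  have hmin1 : min 1 s ≤ 1 := min_le_left _ _
  have hm2 : (∫ x, weight n s x ∂μ - Real.exp (-s)) ^ 2 ≤ min 1 s * (4 * δ ^ 2) := by
    rw [← sq_abs]
    refine (pow_le_pow_left₀ (abs_nonneg _) hm 2).trans ?_
    have : (2 * min 1 s * normDeviation μ n) ^ 2 = min 1 s * (min 1 s * (4 * δ ^ 2)) := by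
      change (2 * min 1 s * δ) ^ 2 = _
      ring
    rw [this]
    exact mul_le_mul_of_nonneg_left (mul_le_of_le_one_left (by positivity) hmin1) hmin0
  have h1n : 0 ≤ 1 / n := by positivity
  -- The three contributions sum to `260/n + 28 δ²`, times `min 1 s`.
  nlinarith [mul_nonneg hmin0 h1n, mul_nonneg hmin0 (sq_nonneg δ)]

end IsotropicLaw

end

/-! ### Cauchy–Schwarz in the frequency and averaging over Gaussian directions -/

section

lemma sq_lintegral_le {α : Type*} [MeasurableSpace α] (κ : Measure α) {f : α → ℝ≥0∞}
    (hf : AEMeasurable f κ) :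
    (∫⁻ a, f a ∂κ) ^ 2 ≤ κ univ * ∫⁻ a, f a ^ 2 ∂κ := by
  have h := ENNReal.lintegral_mul_le_Lp_mul_Lq κ Real.HolderConjugate.two_two hf
    (aemeasurable_const (b := (1 : ℝ≥0∞)))
  simp only [Pi.mul_apply, mul_one, lintegral_const, ENNReal.rpow_ofNat] at h
  calc (∫⁻ a, f a ∂κ) ^ 2 ≤ _ := pow_le_pow_left₀ zero_le h 2
    _ = _ := by
      rw [mul_pow, ← ENNReal.rpow_natCast, ← ENNReal.rpow_mul, ← ENNReal.rpow_natCast,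
        ← ENNReal.rpow_mul]
      norm_num
      rw [mul_comm]

/-- The density with respect to which the Fourier gap is estimated by Cauchy–Schwarz. -/
def gapWeight (T t : ℝ) : ℝ := min T (1 / t) * Real.exp (-t)

def gapMeasure (T : ℝ) : Measure ℝ :=
  (volume.restrict (Ioi 0)).withDensity fun t => ENNReal.ofReal (gapWeight T t)

lemma measurable_gapWeight (T : ℝ) : Measurable (gapWeight T) := by
  unfold gapWeight; fun_prop

lemma gapMeasure_univ_le {T : ℝ} (hT : 1 ≤ T) :
    gapMeasure T univ ≤ ENNReal.ofReal (2 + Real.log T) := by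
  have hT0 : 0 < T := by linarith
  rw [gapMeasure, withDensity_apply _ MeasurableSet.univ, Measure.restrict_univ]
  have hTi : 1 / T ≤ 1 := by rw [div_le_one hT0]; exact hT
  have hT1 : 0 < 1 / T := by positivity
  -- Bounding the weight by `T`, `1/t` and `exp (-t)` on the three pieces gives `1`, `log T` and at
  -- most `1`.
  have hsplit : Ioi (0 : ℝ) = (Ioc 0 (1 / T) ∪ Ioc (1 / T) 1) ∪ Ioi 1 := by
    rw [Ioc_union_Ioc_eq_Ioc hT1.le hTi, Ioc_union_Ioi_eq_Ioi zero_le_one]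
  have h1 : ∫⁻ t in Ioc 0 (1 / T), ENNReal.ofReal (gapWeight T t) ≤ ENNReal.ofReal 1 := by
    calc _ ≤ ∫⁻ t in Ioc 0 (1 / T), ENNReal.ofReal T := by
          refine setLIntegral_mono' measurableSet_Ioc fun t ht => ENNReal.ofReal_le_ofReal ?_
          have h2 : Real.exp (-t) ≤ 1 := Real.exp_le_one_iff.2 (by linarith [ht.1])
          have h3 : 0 < 1 / t := one_div_pos.2 ht.1
          calc gapWeight T t ≤ min T (1 / t) * 1 := by
                unfold gapWeight
                exact mul_le_mul_of_nonneg_left h2 (le_min hT0.le h3.le)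
            _ ≤ T := by rw [mul_one]; exact min_le_left _ _
      _ = ENNReal.ofReal 1 := by
          rw [setLIntegral_const, Real.volume_Ioc, ← ENNReal.ofReal_mul hT0.le]
          congr 1
          field_simp
          ring
  have h2 : ∫⁻ t in Ioc (1 / T) 1, ENNReal.ofReal (gapWeight T t) ≤
      ENNReal.ofReal (Real.log T) := by
    have hint : IntegrableOn (fun t : ℝ => 1 / t) (Ioc (1 / T) 1) := by
      rw [← intervalIntegrable_iff_integrableOn_Ioc_of_le hTi]
      refine intervalIntegral.intervalIntegrable_one_div (fun t ht => ?_) continuousOn_id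
      rw [uIcc_of_le hTi] at ht
      exact (lt_of_lt_of_le hT1 ht.1).ne'
    calc _ ≤ ∫⁻ t in Ioc (1 / T) 1, ENNReal.ofReal (1 / t) := by
          refine setLIntegral_mono' measurableSet_Ioc fun t ht => ENNReal.ofReal_le_ofReal ?_
          have ht0 : 0 < t := lt_trans hT1 ht.1
          have h2 : Real.exp (-t) ≤ 1 := Real.exp_le_one_iff.2 (by linarith)
          have h3 : 0 < 1 / t := one_div_pos.2 ht0
          calc gapWeight T t ≤ min T (1 / t) * 1 := by
                unfold gapWeight
                exact mul_le_mul_of_nonneg_left h2 (le_min hT0.le h3.le)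
            _ ≤ 1 / t := by rw [mul_one]; exact min_le_right _ _
      _ = ENNReal.ofReal (∫ t in Ioc (1 / T) 1, 1 / t) := by
          rw [ofReal_integral_eq_lintegral_ofReal hint]
          filter_upwards [ae_restrict_mem measurableSet_Ioc] with t ht
          exact (one_div_pos.2 (lt_trans hT1 ht.1)).le
      _ = ENNReal.ofReal (Real.log T) := by
          rw [← intervalIntegral.integral_of_le hTi, integral_one_div_of_pos hT1 one_pos]
          simp
  have h3 : ∫⁻ t in Ioi (1 : ℝ), ENNReal.ofReal (gapWeight T t) ≤ ENNReal.ofReal 1 := by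
    have hint : IntegrableOn (fun t : ℝ => Real.exp (-t)) (Ioi 1) :=
      integrableOn_exp_neg_Ioi.mono_set (Ioi_subset_Ioi zero_le_one)
    calc _ ≤ ∫⁻ t in Ioi (1 : ℝ), ENNReal.ofReal (Real.exp (-t)) := by
          refine setLIntegral_mono' measurableSet_Ioi fun t ht => ENNReal.ofReal_le_ofReal ?_
          have ht0 : 1 < t := ht
          have : min T (1 / t) ≤ 1 := (min_le_right _ _).trans
            (by rw [div_le_one (by linarith)]; exact ht0.le)
          exact mul_le_of_le_one_left (Real.exp_pos _).le this
      _ = ENNReal.ofReal (∫ t in Ioi (1 : ℝ), Real.exp (-t)) := by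
          rw [ofReal_integral_eq_lintegral_ofReal hint
            (Eventually.of_forall fun t => (Real.exp_pos _).le)]
      _ ≤ ENNReal.ofReal 1 := by
          rw [integral_exp_neg_Ioi]
          exact ENNReal.ofReal_le_ofReal (Real.exp_le_one_iff.2 (by norm_num))
  rw [hsplit]
  refine (lintegral_union_le _ _ _).trans ((add_le_add (lintegral_union_le _ _ _) le_rfl).trans ?_)
  refine (add_le_add (add_le_add h1 h2) h3).trans ?_
  have := Real.log_nonneg hT
  rw [← ENNReal.ofReal_add one_pos.le this, ← ENNReal.ofReal_add (by linarith) one_pos.le]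
  exact ENNReal.ofReal_le_ofReal (by linarith)

lemma measurable_charFun_real (μ : Measure ℝ) [IsFiniteMeasure μ] : Measurable (charFun μ) :=
  stronglyMeasurable_charFun.measurable

lemma ae_pos_gapMeasure (T : ℝ) : ∀ᵐ t ∂(gapMeasure T), 0 < t :=
  (withDensity_absolutelyContinuous _ _).ae_le (ae_restrict_mem measurableSet_Ioi)

/-- The quadratic vanishing of the mean square bound at `τ = 0` cancels the singular factor created
by Cauchy–Schwarz in `sq_fourierGap_le`. -/
lemma min_one_sq_mul_inv_sq_le (τ : ℝ) : min 1 (τ ^ 2 / 2) * (min τ 1)⁻¹ ^ 2 ≤ 1 := by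
  rcases le_total τ 1 with h | h
  · rw [min_eq_left h]
    rcases eq_or_ne τ 0 with h0 | h0
    · simp [h0]
    · calc min 1 (τ ^ 2 / 2) * τ⁻¹ ^ 2 ≤ τ ^ 2 / 2 * τ⁻¹ ^ 2 := by
            gcongr; exact min_le_right _ _
        _ ≤ 1 := by field_simp; norm_num
  · rw [min_eq_right h]
    simp

/-- Factor `1/t = min T (1/t) · (min (T t) 1)⁻¹`, keep the first factor in the measure, and apply
Cauchy–Schwarz against `1`. Truncating at `T` makes the measure finite. -/
lemma sq_fourierGap_le (μ ν : Measure ℝ) [IsFiniteMeasure μ] [IsFiniteMeasure ν] {T : ℝ}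
    (hT : 0 < T) :
    fourierGap μ ν T ^ 2 ≤ gapMeasure T univ *
      ∫⁻ t, ENNReal.ofReal (‖charFun μ (T * t) - charFun ν (T * t)‖ ^ 2) *
        ENNReal.ofReal ((min (T * t) 1)⁻¹ ^ 2) ∂(gapMeasure T) := by
  have hμ := measurable_charFun_real μ
  have hν := measurable_charFun_real ν
  have hm : Measurable fun t => ENNReal.ofReal
      (‖charFun μ (T * t) - charFun ν (T * t)‖ * (min (T * t) 1)⁻¹) := by fun_prop
  have h1 : fourierGap μ ν T = ∫⁻ t, ENNReal.ofReal
      (‖charFun μ (T * t) - charFun ν (T * t)‖ * (min (T * t) 1)⁻¹) ∂(gapMeasure T) := by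
    rw [gapMeasure, lintegral_withDensity_eq_lintegral_mul _
      (measurable_gapWeight T).ennreal_ofReal hm, fourierGap]
    refine setLIntegral_congr_fun measurableSet_Ioi fun t ht => ?_
    have ht : 0 < t := ht
    have hmin : min T (1 / t) = min (T * t) 1 / t := by
      rw [← min_div_div_right ht.le]
      congr 1
      field_simp
    have hpos : 0 < min (T * t) 1 := by positivity
    simp only [Pi.mul_apply, gapWeight]
    rw [hmin, ← ENNReal.ofReal_mul (by positivity)]
    congr 1
    field_simp
  rw [h1]
  refine (sq_lintegral_le _ hm.aemeasurable).trans (le_of_eq ?_)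
  congr 1
  refine lintegral_congr_ae ?_
  filter_upwards [ae_pos_gapMeasure T] with t ht
  rw [← ENNReal.ofReal_mul (by positivity), ← mul_pow, ENNReal.ofReal_pow (by positivity)]

variable {E : Type*} [NormedAddCommGroup E] [InnerProductSpace ℝ E] [FiniteDimensional ℝ E]
  [MeasurableSpace E] [BorelSpace E]

lemma norm_charFun_sq (μ : Measure E) [IsProbabilityMeasure μ] (w : E) :
    ((‖charFun μ w‖ ^ 2 : ℝ) : ℂ) =
      ∫ p : E × E, Complex.exp (⟪p.1 - p.2, w⟫ * Complex.I) ∂(μ.prod μ) := by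
  have h : ∀ p : E × E, Complex.exp (⟪p.1 - p.2, w⟫ * Complex.I) =
      Complex.exp (⟪p.1, w⟫ * Complex.I) *
        (starRingEnd ℂ) (Complex.exp (⟪p.2, w⟫ * Complex.I)) := by
    intro p
    rw [← Complex.exp_conj, ← Complex.exp_add, inner_sub_left]
    congr 1
    simp
    ring
  simp_rw [h]
  rw [integral_prod_mul (f := fun x : E => Complex.exp (⟪x, w⟫ * Complex.I))
    (g := fun x : E => (starRingEnd ℂ) (Complex.exp (⟪x, w⟫ * Complex.I))), integral_conj]
  change _ = charFun μ w * (starRingEnd ℂ) (charFun μ w)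
  rw [Complex.mul_conj, Complex.normSq_eq_norm_sq]

lemma integrable_exp_inner {α : Type*} [MeasurableSpace α] (P : Measure α) [IsFiniteMeasure P]
    {f g : α → E} (hf : Measurable f) (hg : Measurable g) :
    Integrable (fun x => Complex.exp (⟪f x, g x⟫ * Complex.I)) P := by
  refine Integrable.of_bound (Measurable.aestronglyMeasurable (by fun_prop)) 1
    (Eventually.of_forall fun x => ?_)
  exact (Complex.norm_exp_ofReal_mul_I _).le

lemma integral_exp_inner_stdGaussian (a : ℝ) (x : E) :
    ∫ z, Complex.exp (⟪x, a • z⟫ * Complex.I) ∂(stdGaussian E) =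
      ((Real.exp (-(a ^ 2 / 2 * ‖x‖ ^ 2)) : ℝ) : ℂ) := by
  have h := charFun_stdGaussian (a • x)
  rw [charFun_apply] at h
  have h1 : ∀ z : E, ⟪x, a • z⟫ = ⟪z, a • x⟫ := fun z => by
    rw [real_inner_smul_right, real_inner_smul_right, real_inner_comm]
  simp_rw [h1]
  rw [h, norm_smul]
  push_cast
  congr 1
  rw [mul_pow, ← Complex.ofReal_pow, Real.norm_eq_abs, sq_abs]
  push_cast
  ring

lemma integrable_norm_charFun_sub_sq (μ : Measure E) [IsProbabilityMeasure μ] (a g : ℝ) :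
    Integrable (fun z => ‖charFun μ (a • z) - g‖ ^ 2) (stdGaussian E) := by
  have hm : Measurable (charFun μ) := stronglyMeasurable_charFun.measurable
  refine Integrable.of_bound (Measurable.aestronglyMeasurable (by fun_prop)) ((1 + |g|) ^ 2)
    (Eventually.of_forall fun z => ?_)
  rw [Real.norm_eq_abs, abs_of_nonneg (sq_nonneg _)]
  gcongr
  refine (norm_sub_le _ _).trans ?_
  rw [Complex.norm_real, Real.norm_eq_abs]
  gcongr
  exact norm_charFun_le_one _

/-- The mean square distance of the characteristic function along a Gaussian direction from a
real constant. -/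
lemma integral_norm_charFun_sub_sq (μ : Measure E) [IsProbabilityMeasure μ] (a g : ℝ) :
    ∫ z, ‖charFun μ (a • z) - g‖ ^ 2 ∂(stdGaussian E) =
      ∫ p : E × E, Real.exp (-(a ^ 2 / 2 * ‖p.1 - p.2‖ ^ 2)) ∂(μ.prod μ) -
        2 * g * ∫ x, Real.exp (-(a ^ 2 / 2 * ‖x‖ ^ 2)) ∂μ + g ^ 2 := by
  have hm : Measurable (charFun μ) := stronglyMeasurable_charFun.measurable
  have hexp : ∀ z : E, ‖charFun μ (a • z) - g‖ ^ 2 =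
      ‖charFun μ (a • z)‖ ^ 2 - 2 * g * (charFun μ (a • z)).re + g ^ 2 := by
    intro z
    rw [← Complex.normSq_eq_norm_sq, ← Complex.normSq_eq_norm_sq, Complex.normSq_apply,
      Complex.normSq_apply]
    simp
    ring
  have hi : Integrable (fun z => charFun μ (a • z)) (stdGaussian E) :=
    Integrable.of_bound (Measurable.aestronglyMeasurable (by fun_prop)) 1
      (Eventually.of_forall fun z => norm_charFun_le_one _)
  have hi2 : Integrable (fun z => ‖charFun μ (a • z)‖ ^ 2) (stdGaussian E) := by
    simpa using integrable_norm_charFun_sub_sq μ a 0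
  -- The squared modulus is the characteristic function of `X - Y` with `Y` an independent copy.
  -- Integrating in `z` first yields the Gaussian characteristic function.
  have hS : ∫ z, ‖charFun μ (a • z)‖ ^ 2 ∂(stdGaussian E) =
      ∫ p : E × E, Real.exp (-(a ^ 2 / 2 * ‖p.1 - p.2‖ ^ 2)) ∂(μ.prod μ) := by
    apply Complex.ofReal_injective
    rw [← integral_complex_ofReal, ← integral_complex_ofReal]
    simp_rw [norm_charFun_sq, ← integral_exp_inner_stdGaussian]
    exact integral_integral_swap (integrable_exp_inner ((stdGaussian E).prod (μ.prod μ))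
      (f := fun q => q.2.1 - q.2.2) (g := fun q => a • q.1) (by fun_prop) (by fun_prop))
  have hR : ∫ z, (charFun μ (a • z)).re ∂(stdGaussian E) =
      ∫ x, Real.exp (-(a ^ 2 / 2 * ‖x‖ ^ 2)) ∂μ := by
    have h1 : ∫ z, charFun μ (a • z) ∂(stdGaussian E) =
        ((∫ x, Real.exp (-(a ^ 2 / 2 * ‖x‖ ^ 2)) ∂μ : ℝ) : ℂ) := by
      rw [← integral_complex_ofReal]
      simp_rw [charFun_apply, ← integral_exp_inner_stdGaussian]
      exact integral_integral_swap (integrable_exp_inner ((stdGaussian E).prod μ)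
        (f := fun q => q.2) (g := fun q => a • q.1) (by fun_prop) (by fun_prop))
    have h2 := congrArg Complex.re h1
    rw [Complex.ofReal_re, ← RCLike.re_eq_complex_re, ← integral_re hi] at h2
    exact h2
  simp_rw [hexp]
  have hi3 : Integrable (fun z => 2 * g * (charFun μ (a • z)).re) (stdGaussian E) :=
    hi.re.const_mul _
  have hi4 : Integrable (fun z => ‖charFun μ (a • z)‖ ^ 2 - 2 * g * (charFun μ (a • z)).re)
    (stdGaussian E) := hi2.sub hi3
  rw [integral_add hi4 (integrable_const _), integral_sub hi2 hi3, integral_const_mul, hS, ← hR]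
  simp

/-- The law of `⟨X, z⟩ / √n`. -/
def projLaw (μ : Measure E) (n : ℝ) (z : E) : Measure ℝ := μ.map fun x => ⟪x, z⟫ / √n

instance (μ : Measure E) [IsProbabilityMeasure μ] (n : ℝ) (z : E) :
    IsProbabilityMeasure (projLaw μ n z) :=
  Measure.isProbabilityMeasure_map (Measurable.aemeasurable (by fun_prop))

lemma charFun_projLaw (μ : Measure E) (n : ℝ) (z : E) (τ : ℝ) :
    charFun (projLaw μ n z) τ = charFun μ ((τ / √n) • z) := by
  rw [projLaw, charFun_apply_real, charFun_apply,
    integral_map (Measurable.aemeasurable (by fun_prop))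
      (Measurable.aestronglyMeasurable (by fun_prop))]
  congr 1 with x
  rw [real_inner_smul_right]
  push_cast
  congr 1
  ring

lemma charFun_gaussianReal_zero_one (τ : ℝ) :
    charFun (gaussianReal 0 1) τ = ((Real.exp (-(τ ^ 2 / 2)) : ℝ) : ℂ) := by
  rw [charFun_gaussianReal]
  push_cast
  congr 1
  simp

variable {μ : Measure E} [IsProbabilityMeasure μ] {n : ℝ}

lemma IsotropicLaw.integral_norm_charFun_projLaw_sub_sq_le (h : IsotropicLaw μ n) (τ : ℝ) :
    ∫⁻ z, ENNReal.ofReal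
        (‖charFun (projLaw μ n z) τ - charFun (gaussianReal 0 1) τ‖ ^ 2) ∂(stdGaussian E) ≤
      ENNReal.ofReal (300 * (1 / n + normDeviation μ n ^ 2) * min 1 (τ ^ 2 / 2)) := by
  have hn := h.pos
  simp_rw [charFun_projLaw, charFun_gaussianReal_zero_one]
  rw [← ofReal_integral_eq_lintegral_ofReal (integrable_norm_charFun_sub_sq μ _ _)
    (Eventually.of_forall fun z => sq_nonneg _), integral_norm_charFun_sub_sq]
  refine ENNReal.ofReal_le_ofReal ?_
  have := h.integral_prod_weight_sub_le (s := τ ^ 2 / 2) (by positivity)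
  simp only [IsotropicLaw.weight] at this
  have h2 : (τ / √n) ^ 2 / 2 = τ ^ 2 / 2 / n := by
    rw [div_pow, Real.sq_sqrt hn.le]; ring
  have h3 : ∀ r : ℝ, τ ^ 2 / 2 / n * r = τ ^ 2 / 2 * (r / n) := fun r => by ring
  simp_rw [h2, h3]
  exact this

lemma IsotropicLaw.lintegral_sq_fourierGap_le (h : IsotropicLaw μ n) {T : ℝ} (hT : 1 ≤ T) :
    ∫⁻ z, fourierGap (projLaw μ n z) (gaussianReal 0 1) T ^ 2 ∂(stdGaussian E) ≤
      ENNReal.ofReal (300 * (1 / n + normDeviation μ n ^ 2) * (2 + Real.log T) ^ 2) := by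
  have hn := h.pos
  have hT0 : 0 < T := by linarith
  set B := 300 * (1 / n + normDeviation μ n ^ 2) with hB
  have hB0 : 0 ≤ B := by positivity
  have hm : Measurable (charFun μ) := stronglyMeasurable_charFun.measurable
  have hg := measurable_charFun_real (gaussianReal 0 1)
  have hmeas : Measurable (Function.uncurry fun (z : E) (t : ℝ) => ENNReal.ofReal
      (‖charFun (projLaw μ n z) (T * t) - charFun (gaussianReal 0 1) (T * t)‖ ^ 2) *
        ENNReal.ofReal ((min (T * t) 1)⁻¹ ^ 2)) := by
    simp_rw [charFun_projLaw, Function.uncurry_def]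
    fun_prop
  have : SFinite (gapMeasure T) := by unfold gapMeasure; infer_instance
  calc _ ≤ ∫⁻ z, gapMeasure T univ * ∫⁻ t, ENNReal.ofReal
        (‖charFun (projLaw μ n z) (T * t) - charFun (gaussianReal 0 1) (T * t)‖ ^ 2) *
        ENNReal.ofReal ((min (T * t) 1)⁻¹ ^ 2) ∂(gapMeasure T) ∂(stdGaussian E) :=
        lintegral_mono fun z => sq_fourierGap_le _ _ hT0
    _ = gapMeasure T univ * ∫⁻ t, (∫⁻ z, ENNReal.ofReal
        (‖charFun (projLaw μ n z) (T * t) - charFun (gaussianReal 0 1) (T * t)‖ ^ 2)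
          ∂(stdGaussian E)) * ENNReal.ofReal ((min (T * t) 1)⁻¹ ^ 2) ∂(gapMeasure T) := by
        have hmeas' := hmeas.lintegral_prod_right' (ν := gapMeasure T)
        simp only [Function.uncurry_apply_pair] at hmeas'
        rw [lintegral_const_mul _ hmeas', lintegral_lintegral_swap hmeas.aemeasurable]
        congr 2 with t
        rw [lintegral_mul_const]
        simp_rw [charFun_projLaw]
        fun_prop
    _ ≤ gapMeasure T univ * ∫⁻ t, ENNReal.ofReal B ∂(gapMeasure T) := by
        gcongr with t
        refine (mul_le_mul_left (h.integral_norm_charFun_projLaw_sub_sq_le (T * t)) _).trans ?_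
        rw [← ENNReal.ofReal_mul (by positivity)]
        refine ENNReal.ofReal_le_ofReal ?_
        rw [← hB, mul_assoc]
        refine mul_le_of_le_one_right hB0 ?_
        exact min_one_sq_mul_inv_sq_le _
    -- One factor of the mass comes from Cauchy–Schwarz, the other from integrating the constant
    -- `B`; hence the squared logarithm.
    _ = ENNReal.ofReal B * gapMeasure T univ ^ 2 := by
        rw [lintegral_const]; ring
    _ ≤ ENNReal.ofReal B * ENNReal.ofReal (2 + Real.log T) ^ 2 := by
        gcongr
        exact gapMeasure_univ_le hT
    _ = _ := by
        rw [← ENNReal.ofReal_pow (by linarith [Real.log_nonneg hT]), ← ENNReal.ofReal_mul hB0]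

end

/-! ### The normal distribution function, rescaling, and the length of a Gaussian vector -/

section

lemma integrable_exp_neg_sq_div_two : Integrable fun y : ℝ => Real.exp (-y ^ 2 / 2) := by
  have := integrable_exp_neg_mul_sq (b := 1 / 2) (by norm_num)
  refine this.congr (Eventually.of_forall fun x => ?_)
  simp only
  ring_nf

lemma hasDerivAt_normalCDF (x : ℝ) :
    HasDerivAt normalCDF (1 / √(2 * Real.pi) * Real.exp (-x ^ 2 / 2)) x := by
  have hc : Continuous fun y : ℝ => Real.exp (-y ^ 2 / 2) := by fun_prop
  have h1 : normalCDF = fun x => 1 / √(2 * Real.pi) *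
      ((∫ y in Iic 0, Real.exp (-y ^ 2 / 2)) + ∫ y in (0 : ℝ)..x, Real.exp (-y ^ 2 / 2)) := by
    ext x
    rw [normalCDF, ← intervalIntegral.integral_Iic_sub_Iic
      integrable_exp_neg_sq_div_two.integrableOn integrable_exp_neg_sq_div_two.integrableOn]
    ring
  rw [h1]
  exact ((intervalIntegral.integral_hasDerivAt_right (hc.intervalIntegrable _ _)
    (hc.stronglyMeasurableAtFilter _ _) hc.continuousAt).const_add _).const_mul _

lemma one_div_sqrt_two_pi_le_one : 1 / √(2 * Real.pi) ≤ 1 := by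
  rw [div_le_one (by positivity), Real.one_le_sqrt]
  linarith [Real.pi_gt_three]

lemma normalCDF_eq_cdf : normalCDF = cdf (gaussianReal 0 1) := by
  ext x
  rw [cdf_eq_real, measureReal_def, gaussianReal_apply_eq_integral _ one_ne_zero,
    ENNReal.toReal_ofReal (integral_nonneg fun y => gaussianPDFReal_nonneg _ _ _), normalCDF,
    ← integral_const_mul]
  congr 1 with y
  simp [gaussianPDFReal]

lemma cdf_gaussianReal_sub_le {x y : ℝ} (h : x ≤ y) :
    cdf (gaussianReal 0 1) y - cdf (gaussianReal 0 1) x ≤ y - x := by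
  rw [← normalCDF_eq_cdf]
  have := convex_univ.norm_image_sub_le_of_norm_hasDerivWithin_le (𝕜 := ℝ) (f := normalCDF)
    (C := 1) (fun z _ => (hasDerivAt_normalCDF z).hasDerivWithinAt) (fun z _ => ?_)
    (mem_univ x) (mem_univ y)
  · rw [one_mul, Real.norm_eq_abs, Real.norm_eq_abs, abs_of_nonneg (sub_nonneg.2 h)] at this
    exact (le_abs_self _).trans this
  · rw [Real.norm_eq_abs, abs_of_nonneg (by positivity)]
    refine mul_le_one₀ one_div_sqrt_two_pi_le_one (Real.exp_pos _).le ?_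
    exact Real.exp_le_one_iff.2 (by nlinarith [sq_nonneg z])

lemma abs_mul_exp_neg_sq_le (y : ℝ) : |y| * Real.exp (-y ^ 2 / 2) ≤ 1 := by
  have h1 := mul_exp_neg_le_one (y ^ 2 / 2)
  have h2 : Real.exp (-y ^ 2 / 2) ≤ 1 := Real.exp_le_one_iff.2 (by nlinarith [sq_nonneg y])
  rw [← neg_div] at h1
  have h3 := Real.exp_pos (-y ^ 2 / 2)
  have h4 : (|y| * Real.exp (-y ^ 2 / 2)) ^ 2 ≤ 2 := by
    rw [mul_pow, sq_abs]; nlinarith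
  have h5 := Real.add_one_le_exp (y ^ 2 / 2)
  have h6 : Real.exp (y ^ 2 / 2) * Real.exp (-y ^ 2 / 2) = 1 := by
    rw [← Real.exp_add, neg_div]; simp
  have h7 : |y| ≤ Real.exp (y ^ 2 / 2) := by nlinarith [sq_abs y, sq_nonneg (|y| - 1)]
  nlinarith

/-- The normal distribution function is Lipschitz with respect to changes of scale. -/
lemma abs_normalCDF_div_sub_le {r : ℝ} (hr : 0 < r) (x : ℝ) :
    |normalCDF (x / r) - normalCDF x| ≤ 2 * |r - 1| := by
  -- For `r ≥ 1/2` the mean value theorem in `r` applies, `|y| exp (-y²/2)` being bounded and `1/r ≤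
  -- 2`. For `r < 1/2` the right side exceeds `1`.
  rcases le_or_gt (1 / 2) r with h | h
  · have := (convex_Ici (1 / 2 : ℝ)).norm_image_sub_le_of_norm_hasDerivWithin_le (𝕜 := ℝ)
      (f := fun r => normalCDF (x / r)) (C := 2)
      (f' := fun r => 1 / √(2 * Real.pi) * Real.exp (-(x / r) ^ 2 / 2) * (-x / r ^ 2))
      (fun z hz => ?_) (fun z hz => ?_) (show (1 : ℝ) ∈ Ici (1 / 2 : ℝ) by norm_num [mem_Ici]) h
    · simpa using this
    · have hz0 : z ≠ 0 := (lt_of_lt_of_le (by norm_num) (mem_Ici.1 hz)).ne'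
      have h1 : HasDerivAt (fun r : ℝ => x / r) (-x / z ^ 2) z := by
        simpa [div_eq_mul_inv] using (hasDerivAt_inv hz0).const_mul x
      exact ((hasDerivAt_normalCDF (x / z)).comp z h1).hasDerivWithinAt
    · have hz0 : 0 < z := lt_of_lt_of_le (by norm_num) (mem_Ici.1 hz)
      rw [Real.norm_eq_abs, abs_mul, abs_of_nonneg (by positivity)]
      have h1 : |(-x / z ^ 2)| = |x / z| * (1 / z) := by
        rw [neg_div, abs_neg, sq, ← div_div, abs_div, abs_of_pos hz0]; ring
      have h2 : 1 / z ≤ 2 := by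
        rw [div_le_iff₀ hz0]; linarith [mem_Ici.1 hz]
      have h3 := abs_mul_exp_neg_sq_le (x / z)
      calc 1 / √(2 * Real.pi) * Real.exp (-(x / z) ^ 2 / 2) * |(-x / z ^ 2)|
          = 1 / √(2 * Real.pi) * (|x / z| * Real.exp (-(x / z) ^ 2 / 2)) * (1 / z) := by
            rw [h1]; ring
        _ ≤ 1 * 1 * 2 := by
            gcongr
            exact one_div_sqrt_two_pi_le_one
        _ = 2 := by norm_num
  · have h1 : 1 ≤ 2 * |r - 1| := by rw [abs_of_nonpos (by linarith)]; linarith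
    refine le_trans ?_ h1
    rw [normalCDF_eq_cdf, abs_le]
    have := cdf_nonneg (gaussianReal 0 1) x
    have := cdf_nonneg (gaussianReal 0 1) (x / r)
    have := cdf_le_one (gaussianReal 0 1) x
    have := cdf_le_one (gaussianReal 0 1) (x / r)
    constructor <;> linarith

variable {E : Type*} [NormedAddCommGroup E] [InnerProductSpace ℝ E] [FiniteDimensional ℝ E]
  [MeasurableSpace E] [BorelSpace E]

lemma cdf_projLaw (μ : Measure E) [IsProbabilityMeasure μ] (n : ℝ) (z : E) (t : ℝ) :
    cdf (projLaw μ n z) t = μ.real {x | ⟪x, z⟫ / √n ≤ t} := by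
  rw [cdf_eq_real, projLaw, map_measureReal_apply (by fun_prop) measurableSet_Iic]
  rfl

/-- The event `⟨X, θ⟩ ≤ t` is `⟨X, rθ⟩ / √n ≤ (r/√n) t`, so only the argument of `Φ` changes. -/
lemma kolmogorovDist_projLaw_le (μ : Measure E) [IsProbabilityMeasure μ] {n r : ℝ} (hn : 0 < n)
    (hr : 0 < r) (θ : E) :
    kolmogorovDist (cdf (projLaw μ 1 θ)) (cdf (gaussianReal 0 1)) ≤
      kolmogorovDist (cdf (projLaw μ n (r • θ))) (cdf (gaussianReal 0 1)) +
        2 * |r / √n - 1| := by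
  have hq : 0 < √n := Real.sqrt_pos.2 hn
  have hrn : 0 < r / √n := by positivity
  refine ciSup_le fun t => ?_
  have h1 : cdf (projLaw μ 1 θ) t = cdf (projLaw μ n (r • θ)) (r / √n * t) := by
    rw [cdf_projLaw, cdf_projLaw]
    congr 1
    ext x
    simp only [mem_ofPred_eq, Real.sqrt_one, div_one, real_inner_smul_right]
    rw [div_mul_eq_mul_div, div_le_div_iff_of_pos_right hq, mul_le_mul_iff_right₀ hr]
  have h2 := abs_cdf_sub_le_kolmogorovDist (projLaw μ n (r • θ)) (gaussianReal 0 1) (r / √n * t)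
  have h3 := abs_normalCDF_div_sub_le hrn (r / √n * t)
  rw [mul_div_cancel_left₀ _ hrn.ne', normalCDF_eq_cdf, abs_sub_comm] at h3
  rw [h1]
  exact (abs_sub_le _ _ _).trans (add_le_add h2 h3)

/-- The variance of the square of a standard normal variable. -/
def gaussianSqVar : ℝ := Var[fun x => x ^ 2; gaussianReal 0 1]

lemma memLp_sq_gaussianReal : MemLp (fun x : ℝ => x ^ 2) 2 (gaussianReal 0 1) := by
  have h := memLp_id_gaussianReal (μ := 0) (v := 1) 4
  rw [memLp_two_iff_integrable_sq (by fun_prop)]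
  have := h.integrable_norm_pow (p := 4) (by norm_num)
  refine this.congr (Eventually.of_forall fun x => ?_)
  simp only [id, Real.norm_eq_abs]
  rw [← pow_mul, Even.pow_abs (by decide)]

lemma integral_sq_gaussianReal : ∫ x, x ^ 2 ∂(gaussianReal 0 1) = 1 := by
  have h := variance_id_gaussianReal (μ := 0) (v := 1)
  rw [variance_eq_integral (by fun_prop)] at h
  simpa using h

lemma integral_norm_sq_sub_sq_stdGaussian :
    Integrable (fun z : E => (‖z‖ ^ 2 - Module.finrank ℝ E) ^ 2) (stdGaussian E) ∧
    ∫ z : E, (‖z‖ ^ 2 - Module.finrank ℝ E) ^ 2 ∂(stdGaussian E) =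
      Module.finrank ℝ E * gaussianSqVar := by
  set d := Module.finrank ℝ E
  set π := Measure.pi fun _ : Fin d => gaussianReal 0 1
  set b := stdOrthonormalBasis ℝ E
  have hnorm : ∀ x : Fin d → ℝ, ‖∑ i, x i • b i‖ ^ 2 = ∑ i, x i ^ 2 := by
    intro x
    rw [← real_inner_self_eq_norm_sq, b.orthonormal.inner_sum]
    simp only [conj_trivial, sq]
    rfl
  have hmem : ∀ i : Fin d, MemLp (fun x : Fin d → ℝ => x i ^ 2) 2 π := fun i =>
    memLp_sq_gaussianReal.comp_measurePreserving (measurePreserving_eval _ i)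
  have hmemS : MemLp (fun x : Fin d → ℝ => ∑ i, x i ^ 2) 2 π := memLp_finsetSum _ fun i _ => hmem i
  have hmean : ∫ x, ∑ i, x i ^ 2 ∂π = d := by
    rw [integral_finsetSum _ fun i _ => (hmem i).integrable (by norm_num)]
    have : ∀ i : Fin d, ∫ x : Fin d → ℝ, x i ^ 2 ∂π = 1 := fun i => by
      rw [← integral_sq_gaussianReal]
      exact integral_comp_eval (μ := fun _ : Fin d => gaussianReal 0 1) (i := i)
        (f := fun y : ℝ => y ^ 2) (Measurable.aestronglyMeasurable (by fun_prop))
    simp [this]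
  have hvar := variance_sum_pi (μ := fun _ : Fin d => gaussianReal 0 1)
    (X := fun _ x => x ^ 2) fun _ => memLp_sq_gaussianReal
  have heq : (∑ i : Fin d, fun ω : Fin d → ℝ => ω i ^ 2) = fun x => ∑ i, x i ^ 2 := by
    ext x; simp
  rw [heq, variance_eq_integral hmemS.aestronglyMeasurable.aemeasurable, hmean] at hvar
  have hphi : AEMeasurable (fun x : Fin d → ℝ => ∑ i, x i • b i) π :=
    Measurable.aemeasurable (by fun_prop)
  constructor
  · rw [stdGaussian, integrable_map_measure (Measurable.aestronglyMeasurable (by fun_prop)) hphi]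
    simp only [Function.comp_def]
    simp_rw [hnorm]
    exact (hmemS.sub (memLp_const _)).integrable_sq
  · rw [stdGaussian, integral_map hphi (Measurable.aestronglyMeasurable (by fun_prop))]
    change ∫ x : Fin d → ℝ, (‖∑ i, x i • b i‖ ^ 2 - d) ^ 2 ∂π = _
    simp_rw [hnorm]
    rw [hvar]
    simp [gaussianSqVar]

/-- With `r = ‖z‖ / √d`, `(r - 1)² ≤ (r² - 1)²` because `r + 1 ≥ 1`; the right side is governed by
the variance of `‖z‖²`. -/
lemma lintegral_norm_div_sqrt_sub_one_sq_le (hd : 0 < Module.finrank ℝ E) :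
    ∫⁻ z : E, ENNReal.ofReal ((‖z‖ / √(Module.finrank ℝ E) - 1) ^ 2) ∂(stdGaussian E) ≤
      ENNReal.ofReal (gaussianSqVar / Module.finrank ℝ E) := by
  obtain ⟨hi, hI⟩ := integral_norm_sq_sub_sq_stdGaussian (E := E)
  set d : ℝ := (Module.finrank ℝ E : ℝ) with hd'
  have hd0 : 0 < d := Nat.cast_pos.2 hd
  have hs : √d ^ 2 = d := Real.sq_sqrt hd0.le
  calc _ ≤ ∫⁻ z : E, ENNReal.ofReal ((‖z‖ ^ 2 - d) ^ 2 / d ^ 2) ∂(stdGaussian E) := by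
        refine lintegral_mono fun z => ENNReal.ofReal_le_ofReal ?_
        have hr : 0 ≤ ‖z‖ / √d := by positivity
        have h1 : (‖z‖ ^ 2 - d) ^ 2 / d ^ 2 = ((‖z‖ / √d) ^ 2 - 1) ^ 2 := by
          rw [div_pow ‖z‖, hs]; field_simp
        rw [h1]
        have h2 : ((‖z‖ / √d) ^ 2 - 1) ^ 2 = (‖z‖ / √d - 1) ^ 2 * (‖z‖ / √d + 1) ^ 2 := by ring
        rw [h2]
        refine le_mul_of_one_le_right (sq_nonneg _) ?_
        exact one_le_pow₀ (by linarith)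
    _ = ENNReal.ofReal (∫ z : E, (‖z‖ ^ 2 - d) ^ 2 / d ^ 2 ∂(stdGaussian E)) := by
        rw [ofReal_integral_eq_lintegral_ofReal (hi.div_const _)
          (Eventually.of_forall fun z => by positivity)]
    _ = _ := by
        rw [integral_div, hI]
        congr 1
        field_simp

end

/-! ### Polar decomposition of the Gaussian measure -/

section

variable {E : Type*} [NormedAddCommGroup E] [InnerProductSpace ℝ E] [FiniteDimensional ℝ E]
  [MeasurableSpace E] [BorelSpace E]

variable (E) in
/-- The density of the standard Gaussian measure on `E` as a function of the norm. -/
def gaussianRadial (r : ℝ) : ℝ≥0∞ :=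
  ENNReal.ofReal ((∫ v : E, Real.exp (-(1 / 2) * ‖v‖ ^ 2))⁻¹ * Real.exp (-(1 / 2) * r ^ 2))

lemma measurable_gaussianRadial : Measurable (gaussianRadial E) := by
  unfold gaussianRadial; fun_prop

lemma integral_exp_neg_half_norm_sq_pos : 0 < ∫ v : E, Real.exp (-(1 / 2) * ‖v‖ ^ 2) := by
  rw [GaussianFourier.integral_rexp_neg_mul_sq_norm (by norm_num)]
  positivity

lemma stdGaussian_eq_withDensity :
    stdGaussian E = (volume : Measure E).withDensity fun z => gaussianRadial E ‖z‖ := by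
  have hN := integral_exp_neg_half_norm_sq_pos (E := E)
  set N := ∫ v : E, Real.exp (-(1 / 2) * ‖v‖ ^ 2) with hNdef
  have hm : Measurable fun z : E => gaussianRadial E ‖z‖ :=
    measurable_gaussianRadial.comp measurable_norm
  have hint : Integrable fun v : E => N⁻¹ * Real.exp (-(1 / 2) * ‖v‖ ^ 2) := by
    refine Integrable.const_mul ?_ _
    -- A non-integrable function has integral `0` by convention, so positivity of the integral
    -- forces integrability.
    by_contra hc
    rw [hNdef, integral_undef hc] at hN
    exact lt_irrefl _ hN
  have hfin : IsFiniteMeasure ((volume : Measure E).withDensity fun z => gaussianRadial E ‖z‖) := by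
    refine ⟨?_⟩
    rw [withDensity_apply _ MeasurableSet.univ, Measure.restrict_univ]
    exact hint.lintegral_lt_top
  refine Measure.ext_of_charFun ?_
  ext t
  rw [charFun_stdGaussian, charFun_apply, integral_withDensity_eq_integral_toReal_smul hm
    (Eventually.of_forall fun z => ENNReal.ofReal_lt_top)]
  have h1 : ∀ v : E, (gaussianRadial E ‖v‖).toReal • Complex.exp (⟪v, t⟫ * Complex.I) =
      (N⁻¹ : ℂ) * Complex.exp (-(1 / 2 : ℂ) * ‖v‖ ^ 2 + Complex.I * ⟪t, v⟫) := by
    intro v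
    rw [gaussianRadial, ENNReal.toReal_ofReal (by positivity), Complex.exp_add, real_inner_comm,
      Complex.real_smul]
    push_cast
    rw [mul_comm Complex.I, mul_assoc]
  simp_rw [h1]
  have h0 : (0 : ℝ) < (1 / 2 : ℂ).re := by norm_num
  have hNc : (N : ℂ) = (Real.pi / (1 / 2 : ℂ)) ^ (Module.finrank ℝ E / 2 : ℂ) := by
    rw [← GaussianFourier.integral_cexp_neg_mul_sq_norm (V := E) h0, hNdef,
      ← integral_complex_ofReal]
    congr 1 with v
    push_cast
    rfl
  rw [integral_const_mul, GaussianFourier.integral_cexp_neg_mul_sq_norm_add h0, ← hNc, ← mul_assoc,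
    inv_mul_cancel₀ (by exact_mod_cast hN.ne'), one_mul, Complex.I_sq]
  congr 1
  ring

lemma lintegral_stdGaussian_eq [Nontrivial E] (f : E → ℝ≥0∞) :
    ∫⁻ z, f z ∂(stdGaussian E) =
      ∫⁻ p : Metric.sphere (0 : E) 1 × Ioi (0 : ℝ), gaussianRadial E p.2 * f ((p.2 : ℝ) • (p.1 : E))
        ∂((volume : Measure E).toSphere.prod (.volumeIoiPow (Module.finrank ℝ E - 1))) := by
  have hm : Measurable fun z : E => gaussianRadial E ‖z‖ :=
    measurable_gaussianRadial.comp measurable_norm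
  have hsub : ∀ g : E → ℝ≥0∞, ∫⁻ z, g z =
      ∫⁻ z : ({0}ᶜ : Set E), g z ∂((volume : Measure E).comap (↑)) := fun g => by
    rw [lintegral_subtype_comap (measurableSet_singleton _).compl, restrict_compl_singleton]
  rw [stdGaussian_eq_withDensity, lintegral_withDensity_eq_lintegral_mul_non_measurable _ hm
    (Eventually.of_forall fun z => ENNReal.ofReal_lt_top),
    ← (volume : Measure E).measurePreserving_homeomorphUnitSphereProd.lintegral_comp_emb
      (Homeomorph.measurableEmbedding _), hsub]
  congr 1 with z
  have hz : ‖(z : E)‖ ≠ 0 := norm_ne_zero_iff.2 z.2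
  simp [smul_smul, mul_inv_cancel₀ hz]

/-- Comparison of an integral over the sphere with a Gaussian integral. -/
lemma lintegral_sphere_le_lintegral_stdGaussian {H : Metric.sphere (0 : E) 1 → ℝ≥0∞}
    [Nontrivial E] {f : E → ℝ≥0∞} (hH : Measurable H)
    (h : ∀ (θ : Metric.sphere (0 : E) 1) (r : ℝ), 0 < r → H θ ≤ f (r • (θ : E))) :
    ∫⁻ θ, H θ ∂(((volume : Measure E).toSphere univ)⁻¹ • (volume : Measure E).toSphere) ≤
      ∫⁻ z, f z ∂(stdGaussian E) := by
  have hr : Measurable fun r : Ioi (0 : ℝ) => gaussianRadial E r :=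
    measurable_gaussianRadial.comp measurable_subtype_coe
  set S := (volume : Measure E).toSphere
  set κ := Measure.volumeIoiPow (Module.finrank ℝ E - 1)
  -- The Gaussian total mass in polar coordinates: the radial mass is exactly the constant
  -- normalizing the surface measure.
  have hone : S univ * ∫⁻ r, gaussianRadial E r ∂κ = 1 := by
    have h1 := lintegral_stdGaussian_eq (E := E) fun _ => 1
    simp only [lintegral_const, measure_univ, mul_one] at h1
    have h2 := lintegral_prod_mul (μ := S) (ν := κ) (f := fun _ => 1)
      (g := fun r => gaussianRadial E r) aemeasurable_const hr.aemeasurable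
    simp only [one_mul, lintegral_const] at h2
    rw [← h2, ← h1]
  have hinv : (S univ)⁻¹ = ∫⁻ r, gaussianRadial E r ∂κ :=
    (ENNReal.eq_inv_of_mul_eq_one_left (by rw [mul_comm]; exact hone)).symm
  rw [lintegral_smul_measure, hinv, smul_eq_mul, mul_comm,
    ← lintegral_prod_mul hH.aemeasurable hr.aemeasurable, lintegral_stdGaussian_eq]
  refine lintegral_mono fun p => ?_
  rw [mul_comm]
  gcongr
  exact h p.1 p.2 p.2.2

end

/-! ### Measurability of the distance and the mean square bound on the sphere -/

/-- Right continuity reduces the supremum to a countable one, which makes the distance measurable in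
the direction. -/
lemma kolmogorovDist_cdf_eq_iSup_rat (μ ν : Measure ℝ) :
    kolmogorovDist (cdf μ) (cdf ν) = ⨆ q : ℚ, |cdf μ q - cdf ν q| := by
  have hbdd : BddAbove (range fun q : ℚ => |cdf μ q - cdf ν q|) :=
    (bddAbove_range_abs_cdf_sub μ ν).mono (range_comp_subset_range (fun q : ℚ => (q : ℝ))
      fun x => |cdf μ x - cdf ν x|)
  refine le_antisymm (ciSup_le fun x => ?_) (ciSup_le fun q => abs_cdf_sub_le_kolmogorovDist μ ν q)
  by_contra! hc
  have hcont : Tendsto (fun y => |cdf μ y - cdf ν y|) (𝓝[>] x) (𝓝 |cdf μ x - cdf ν x|) :=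
    ((((cdf μ).right_continuous x).sub ((cdf ν).right_continuous x)).abs.mono
      Ioi_subset_Ici_self)
  obtain ⟨u, hu, hsub⟩ := mem_nhdsGT_iff_exists_Ioo_subset.1 (hcont.eventually (lt_mem_nhds hc))
  obtain ⟨q, hq1, hq2⟩ := exists_rat_btwn (mem_Ioi.1 hu)
  exact absurd (le_ciSup hbdd q) (not_le.2 (hsub ⟨hq1, hq2⟩))

lemma kolmogorovDist_cdf_le_one (μ ν : Measure ℝ) : kolmogorovDist (cdf μ) (cdf ν) ≤ 1 := by
  refine ciSup_le fun x => ?_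
  rw [abs_le]
  constructor <;> linarith [cdf_nonneg μ x, cdf_le_one μ x, cdf_nonneg ν x, cdf_le_one ν x]

lemma sq_integral_le {α : Type*} [MeasurableSpace α] {P : Measure α} [IsProbabilityMeasure P]
    {f : α → ℝ} (hf : Integrable f P) (hf2 : Integrable (fun x => f x ^ 2) P) :
    (∫ x, f x ∂P) ^ 2 ≤ ∫ x, f x ^ 2 ∂P := by
  set m := ∫ x, f x ∂P with hm
  have h1 : 0 ≤ ∫ x, (f x ^ 2 - 2 * m * f x + m ^ 2) ∂P :=
    integral_nonneg fun x => by
      change 0 ≤ f x ^ 2 - 2 * m * f x + m ^ 2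
      nlinarith [sq_nonneg (f x - m)]
  have hi : Integrable (fun x => 2 * m * f x) P := hf.const_mul _
  have hi2 : Integrable (fun x => f x ^ 2 - 2 * m * f x) P := hf2.sub hi
  rw [integral_add hi2 (integrable_const _), integral_sub hf2 hi, integral_const_mul,
    ← hm] at h1
  simp at h1
  nlinarith

section Law

variable {E : Type*} [NormedAddCommGroup E] [InnerProductSpace ℝ E] [FiniteDimensional ℝ E]
  [MeasurableSpace E] [BorelSpace E] {μ : Measure E} [IsProbabilityMeasure μ]

lemma measurable_kolmogorovDist_projLaw (μ : Measure E) [IsProbabilityMeasure μ] (n : ℝ)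
    (ν : Measure ℝ) :
    Measurable fun z => kolmogorovDist (cdf (projLaw μ n z)) (cdf ν) := by
  simp_rw [kolmogorovDist_cdf_eq_iSup_rat]
  refine Measurable.iSup fun q => ?_
  simp_rw [cdf_projLaw]
  have hs : MeasurableSet {p : E × E | ⟪p.2, p.1⟫ / √n ≤ q} :=
    measurableSet_le (by fun_prop) (by fun_prop)
  have h1 : Measurable fun z : E => μ.real {x | ⟪x, z⟫ / √n ≤ q} :=
    (measurable_measure_prodMk_left (ν := μ) hs).ennreal_toReal
  exact (h1.sub_const _).abs

lemma IsotropicLaw.integrable_id_projLaw {n : ℝ} (h : IsotropicLaw μ n) (z : E) :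
    Integrable id (projLaw μ n z) := by
  rw [projLaw, integrable_map_measure (by fun_prop) (Measurable.aemeasurable (by fun_prop))]
  refine Integrable.div_const ?_ _
  refine Integrable.mono' (h.integrable_norm.mul_const ‖z‖)
    (Measurable.aestronglyMeasurable (by fun_prop)) (Eventually.of_forall fun x => ?_)
  exact abs_real_inner_le_norm x z

lemma ofReal_sq_le_of_ofReal_le {x y w : ℝ} {a : ℝ≥0∞} (hx : 0 ≤ x) (hy : 0 ≤ y) (hw : 0 ≤ w)
    (h : ENNReal.ofReal x ≤ a + ENNReal.ofReal y + ENNReal.ofReal w) :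
    ENNReal.ofReal (x ^ 2) ≤
      3 * a ^ 2 + ENNReal.ofReal (3 * y ^ 2) + ENNReal.ofReal (3 * w ^ 2) := by
  rcases eq_or_ne a ⊤ with ha | ha
  · simp [ha]
  lift a to NNReal using ha
  have ha : (a : ℝ≥0∞) = ENNReal.ofReal a := (ENNReal.ofReal_coe_nnreal).symm
  have ha0 : 0 ≤ (a : ℝ) := a.2
  rw [ha, ← ENNReal.ofReal_add ha0 hy, ← ENNReal.ofReal_add (by positivity) hw,
    ENNReal.ofReal_le_ofReal_iff (by positivity)] at h
  rw [ha, ← ENNReal.ofReal_pow ha0, show (3 : ℝ≥0∞) = ENNReal.ofReal 3 by simp,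
    ← ENNReal.ofReal_mul (by norm_num), ← ENNReal.ofReal_add (by positivity) (by positivity),
    ← ENNReal.ofReal_add (by positivity) (by positivity)]
  refine ENNReal.ofReal_le_ofReal ?_
  nlinarith [pow_le_pow_left₀ hx h 2, sq_nonneg ((a : ℝ) - y), sq_nonneg ((a : ℝ) - w),
    sq_nonneg (y - w)]

lemma gaussianSqVar_nonneg : 0 ≤ gaussianSqVar := variance_nonneg _ _

/-- The mean square Kolmogorov distance of the projections of an isotropic law along the sphere
to the standard normal law. -/
lemma IsotropicLaw.lintegral_sq_kolmogorovDist_le [Nontrivial E] {n : ℝ}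
    (hn : n = Module.finrank ℝ E) (hn2 : 2 ≤ n) (h : IsotropicLaw μ n) :
    ∫⁻ θ : Metric.sphere (0 : E) 1, ENNReal.ofReal
        (kolmogorovDist (cdf (projLaw μ 1 (θ : E))) (cdf (gaussianReal 0 1)) ^ 2)
        ∂(((volume : Measure E).toSphere univ)⁻¹ • (volume : Measure E).toSphere) ≤
      ENNReal.ofReal ((20000 + 48 * gaussianSqVar) * (1 / n + normDeviation μ n ^ 2) *
        Real.log n ^ 2) := by
  have hn0 := h.pos
  set B := 1 / n + normDeviation μ n ^ 2 with hB
  have hK := gaussianSqVar_nonneg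
  have hmeas : Measurable fun θ : Metric.sphere (0 : E) 1 => ENNReal.ofReal
      (kolmogorovDist (cdf (projLaw μ 1 (θ : E))) (cdf (gaussianReal 0 1)) ^ 2) :=
    (((measurable_kolmogorovDist_projLaw μ 1 _).comp measurable_subtype_coe).pow_const
      2).ennreal_ofReal
  -- The smoothing parameter is `T = n`. The three terms are the Fourier gap, the smoothing error
  -- and the rescaling error, with factors `3` from squaring a sum of three.
  refine (lintegral_sphere_le_lintegral_stdGaussian (f := fun z =>
    3 * fourierGap (projLaw μ n z) (gaussianReal 0 1) n ^ 2 + ENNReal.ofReal (3 * (8 / n) ^ 2) +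
      ENNReal.ofReal (3 * (2 * |‖z‖ / √n - 1|) ^ 2)) hmeas fun θ r hr => ?_).trans ?_
  · refine ofReal_sq_le_of_ofReal_le (kolmogorovDist_cdf_nonneg _ _) (by positivity)
      (by positivity) ?_
    have hθ : ‖r • (θ : E)‖ = r := by
      rw [norm_smul, norm_eq_of_mem_sphere, mul_one, Real.norm_eq_abs, abs_of_pos hr]
    have h1 := kolmogorovDist_projLaw_le μ hn0 hr (θ : E)
    have h2 := kolmogorovDist_le_fourierGap (projLaw μ n (r • (θ : E))) (gaussianReal 0 1)
      (h.integrable_id_projLaw _)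
      ((memLp_id_gaussianReal (μ := 0) (v := 1) 1).integrable le_rfl) hn0
      fun x y hxy => cdf_gaussianReal_sub_le hxy
    rw [hθ]
    refine (ENNReal.ofReal_le_ofReal h1).trans ?_
    rw [ENNReal.ofReal_add (kolmogorovDist_cdf_nonneg _ _) (by positivity)]
    gcongr
  · have hr := lintegral_norm_div_sqrt_sub_one_sq_le (E := E)
      (by exact_mod_cast (show (0 : ℝ) < _ from hn ▸ hn0))
    rw [← hn] at hr
    have hg := h.lintegral_sq_fourierGap_le (T := n) (by linarith)
    have h12 : ∀ z : E, ENNReal.ofReal (3 * (2 * |‖z‖ / √n - 1|) ^ 2) =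
        ENNReal.ofReal 12 * ENNReal.ofReal ((‖z‖ / √n - 1) ^ 2) := fun z => by
      rw [← ENNReal.ofReal_mul (by norm_num), mul_pow, sq_abs]
      ring_nf
    simp_rw [h12]
    rw [lintegral_add_right _ (by fun_prop), lintegral_add_right _ (by fun_prop),
      lintegral_const_mul' _ _ (by simp), lintegral_const_mul' _ _ (by simp), lintegral_const,
      measure_univ, mul_one]
    refine (add_le_add (add_le_add (mul_le_mul_right hg 3) le_rfl)
      (mul_le_mul_right hr _)).trans ?_
    have hlog0 := Real.log_nonneg (show (1 : ℝ) ≤ n by linarith)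
    -- Equivalent to `2 + log n ≤ 4 log n`; it also gives `1 ≤ 4 (log n)²`, so all terms are
    -- absorbed into `B (log n)²`.
    have hlog : 2 / 3 ≤ Real.log n := by
      have := Real.log_le_log (by norm_num) hn2
      linarith [Real.log_two_gt_d9]
    have hB0 : 0 ≤ B := by positivity
    rw [show (3 : ℝ≥0∞) = ENNReal.ofReal 3 by simp, ← ENNReal.ofReal_mul (by norm_num),
      ← ENNReal.ofReal_mul (by norm_num), ← ENNReal.ofReal_add (by positivity) (by positivity),
      ← ENNReal.ofReal_add (by positivity) (by positivity)]
    refine ENNReal.ofReal_le_ofReal ?_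
    rw [← hB]
    have hnB : 1 / n ≤ B := by rw [hB]; linarith [sq_nonneg (normDeviation μ n)]
    have hn1 : 1 / n ≤ 1 := by rw [div_le_one hn0]; linarith
    have hn1' : 0 ≤ 1 / n := by positivity
    have hL2 : 1 ≤ 4 * Real.log n ^ 2 := by nlinarith
    have e1 : 3 * (300 * B * (2 + Real.log n) ^ 2) ≤ 14400 * B * Real.log n ^ 2 := by
      have : (2 + Real.log n) ^ 2 ≤ 16 * Real.log n ^ 2 := by nlinarith
      nlinarith
    have e2 : 3 * (8 / n) ^ 2 ≤ 768 * B * Real.log n ^ 2 := by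
      have h3 : 3 * (8 / n) ^ 2 = 192 * ((1 / n) * (1 / n)) := by ring
      have h4 : (1 / n) * (1 / n) ≤ B := by nlinarith
      nlinarith [mul_le_mul_of_nonneg_left hL2 hB0]
    have e3 : 12 * (gaussianSqVar / n) ≤ 48 * gaussianSqVar * B * Real.log n ^ 2 := by
      have h3 : 12 * (gaussianSqVar / n) = 12 * (gaussianSqVar * (1 / n)) := by ring
      have h4 : gaussianSqVar * (1 / n) ≤ gaussianSqVar * B := by gcongr
      nlinarith [mul_le_mul_of_nonneg_left hL2 (mul_nonneg hK hB0)]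
    nlinarith [mul_nonneg hB0 (sq_nonneg (Real.log n))]

end Law

/-! ### From random vectors to their laws -/

section Isotropic

variable {n : ℕ} {Ω : Type*} [MeasurableSpace Ω] {P : Measure Ω} [IsProbabilityMeasure P]
  {X : Ω → EuclideanSpace ℝ (Fin n)}

lemma IsIsotropic.isotropicLaw (hX : IsIsotropic X P) (hn : 0 < n) :
    IsotropicLaw (P.map X) n := by
  have hm := hX.aemeasurable
  have hsq : ∀ ω, ‖X ω‖ ^ 2 = ∑ i, X ω i * X ω i := fun ω => by
    simp_rw [EuclideanSpace.real_norm_sq_eq, sq]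
  refine ⟨Nat.cast_pos.2 hn, ?_, ?_, fun a => ?_⟩
  · rw [integrable_map_measure (Measurable.aestronglyMeasurable (by fun_prop)) hm]
    simp only [Function.comp_def, hsq]
    exact integrable_finsetSum _ fun i _ => hX.integrable i i
  · rw [integral_map hm (Measurable.aestronglyMeasurable (by fun_prop))]
    simp_rw [hsq]
    rw [integral_finsetSum _ fun i _ => hX.integrable i i]
    simp [hX.integral_eq]
  · rw [integral_map hm (Measurable.aestronglyMeasurable (by fun_prop))]
    have h1 : ∀ ω, ⟪X ω, a⟫ ^ 2 = ∑ i, ∑ j, (a i * a j) * (X ω i * X ω j) := by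
      intro ω
      rw [PiLp.inner_apply, sq, Finset.sum_mul_sum]
      refine Finset.sum_congr rfl fun i _ => Finset.sum_congr rfl fun j _ => ?_
      simp
      ring
    simp_rw [h1]
    rw [integral_finsetSum _ fun i _ => integrable_finsetSum _ fun j _ =>
      (hX.integrable i j).const_mul _]
    simp_rw [integral_finsetSum _ fun j _ => (hX.integrable _ j).const_mul _, integral_const_mul,
      hX.integral_eq]
    rw [EuclideanSpace.real_norm_sq_eq]
    simp [sq]

lemma weightedSumCDF_eq_cdf (hX : AEMeasurable X P)
    (θ : Metric.sphere (0 : EuclideanSpace ℝ (Fin n)) 1) :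
    haveI := Measure.isProbabilityMeasure_map hX
    weightedSumCDF X P θ = cdf (projLaw (P.map X) 1 (θ : EuclideanSpace ℝ (Fin n))) := by
  have := Measure.isProbabilityMeasure_map hX
  ext x
  have hs : MeasurableSet {y : EuclideanSpace ℝ (Fin n) |
      ⟪y, (θ : EuclideanSpace ℝ (Fin n))⟫ / √1 ≤ x} :=
    measurableSet_le (by fun_prop) (by fun_prop)
  rw [cdf_projLaw, measureReal_def, Measure.map_apply_of_aemeasurable hX hs, weightedSumCDF,
    measureReal_def]
  congr 3
  ext ω
  simp [PiLp.inner_apply, mul_comm]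

lemma sigma_one_sq_eq (hX : AEMeasurable X P) :
    sigma 1 X P ^ 2 = n * normDeviation (P.map X) n ^ 2 := by
  rw [sigma, normDeviation, integral_map hX (Measurable.aestronglyMeasurable (by fun_prop)),
    mul_pow, Real.sq_sqrt (Nat.cast_nonneg n)]
  simp

/-- Jensen's inequality. The fourth moment is essential: without it the integral defining `sigma 2`
would take the default value `0`. -/
lemma sigma_one_sq_le (hX : IsIsotropic X P) (hn : 0 < n)
    (h4 : Integrable (fun ω => ‖X ω‖ ^ 4) P) : sigma 1 X P ^ 2 ≤ sigma 2 X P ^ 2 := by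
  have hsq : Integrable (fun ω => ‖X ω‖ ^ 2) P :=
    (hX.isotropicLaw hn).integrable_sq.comp_aemeasurable hX.aemeasurable
  have hY : Integrable (fun ω => |‖X ω‖ ^ 2 / n - 1|) P :=
    ((hsq.div_const _).sub (integrable_const 1)).abs
  have hY2 : Integrable (fun ω => |‖X ω‖ ^ 2 / n - 1| ^ 2) P := by
    refine (((h4.div_const ((n : ℝ) ^ 2)).sub (hsq.mul_const (2 / n))).add
      (integrable_const 1)).congr (Eventually.of_forall fun ω => ?_)
    simp only [Pi.add_apply, Pi.sub_apply, sq_abs]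
    field_simp
    ring
  have h := sq_integral_le hY hY2
  have h0 : 0 ≤ ∫ ω, |‖X ω‖ ^ 2 / n - 1| ^ 2 ∂P := integral_nonneg fun ω => by positivity
  rw [sigma, sigma, mul_pow, mul_pow]
  simp only [Real.rpow_one, div_one, Real.rpow_ofNat]
  rw [← Real.sqrt_eq_rpow, Real.sq_sqrt h0]
  gcongr

lemma isProbabilityMeasure_sphereMeasure (hn : 0 < n) :
    IsProbabilityMeasure (sphereMeasure n) := by
  have : Nontrivial (EuclideanSpace ℝ (Fin n)) :=
    Module.nontrivial_of_finrank_pos (R := ℝ) (by simpa using hn)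
  refine ⟨?_⟩
  rw [sphereMeasure, Measure.smul_apply, smul_eq_mul]
  exact ENNReal.inv_mul_cancel
    (Measure.measure_univ_ne_zero.2 (Measure.toSphere_ne_zero _)) (measure_ne_top _ _)

end Isotropic

end RandomizedCLT

end

/-! ### The main theorem -/

theorem proposition9p1 :
    ∃ c : ℝ, 0 < c ∧
      ∀ (n : ℕ), 2 ≤ n →
      ∀ (Ω : Type*) [MeasurableSpace Ω] (P : Measure Ω) [IsProbabilityMeasure P]
        (X : Ω → EuclideanSpace ℝ (Fin n)), RandomizedCLT.IsIsotropic X P →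
        Integrable (fun θ => RandomizedCLT.kolmogorovDist
            (RandomizedCLT.weightedSumCDF X P θ) RandomizedCLT.normalCDF ^ 2)
          (RandomizedCLT.sphereMeasure n) ∧
        ∫ θ, RandomizedCLT.kolmogorovDist
            (RandomizedCLT.weightedSumCDF X P θ) RandomizedCLT.normalCDF ^ 2
            ∂(RandomizedCLT.sphereMeasure n)
          ≤ c * (1 + RandomizedCLT.sigma 1 X P ^ 2) * (Real.log n) ^ 2 / n ∧
        (Integrable (fun ω => ‖X ω‖ ^ 4) P →
          Integrable (fun θ => RandomizedCLT.kolmogorovDist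
              (RandomizedCLT.weightedSumCDF X P θ) RandomizedCLT.normalCDF)
            (RandomizedCLT.sphereMeasure n) ∧
          ∫ θ, RandomizedCLT.kolmogorovDist
              (RandomizedCLT.weightedSumCDF X P θ) RandomizedCLT.normalCDF
              ∂(RandomizedCLT.sphereMeasure n)
            ≤ Real.sqrt (∫ θ, RandomizedCLT.kolmogorovDist
                (RandomizedCLT.weightedSumCDF X P θ) RandomizedCLT.normalCDF ^ 2
                ∂(RandomizedCLT.sphereMeasure n)) ∧
          Real.sqrt (∫ θ, RandomizedCLT.kolmogorovDist
              (RandomizedCLT.weightedSumCDF X P θ) RandomizedCLT.normalCDF ^ 2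
              ∂(RandomizedCLT.sphereMeasure n))
            ≤ c * (1 + RandomizedCLT.sigma 2 X P) * Real.log n / Real.sqrt n) := by
  have hK := RandomizedCLT.gaussianSqVar_nonneg
  refine ⟨20000 + 48 * RandomizedCLT.gaussianSqVar, by positivity, ?_⟩
  intro n hn Ω _ P _ X hX
  set c := 20000 + 48 * RandomizedCLT.gaussianSqVar with hc
  have hc1 : 1 ≤ c := by linarith
  have hn0 : 0 < n := by omega
  have hnR : (0 : ℝ) < n := Nat.cast_pos.2 hn0
  have hn2 : (2 : ℝ) ≤ n := by exact_mod_cast hn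
  have hm := hX.aemeasurable
  have hμ := Measure.isProbabilityMeasure_map hm
  have hS := RandomizedCLT.isProbabilityMeasure_sphereMeasure hn0
  have hE : Nontrivial (EuclideanSpace ℝ (Fin n)) :=
    Module.nontrivial_of_finrank_pos (R := ℝ) (by simpa using hn0)
  simp_rw [RandomizedCLT.weightedSumCDF_eq_cdf hm, RandomizedCLT.normalCDF_eq_cdf]
  set ρ : Metric.sphere (0 : EuclideanSpace ℝ (Fin n)) 1 → ℝ := fun θ =>
    RandomizedCLT.kolmogorovDist
      (ProbabilityTheory.cdf (RandomizedCLT.projLaw (P.map X) 1 (θ : EuclideanSpace ℝ (Fin n))))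
      (ProbabilityTheory.cdf (ProbabilityTheory.gaussianReal 0 1)) with hρ
  have hρm : Measurable ρ :=
    (RandomizedCLT.measurable_kolmogorovDist_projLaw _ 1 _).comp measurable_subtype_coe
  have hρ0 : ∀ θ, 0 ≤ ρ θ := fun θ => RandomizedCLT.kolmogorovDist_cdf_nonneg _ _
  have hρ1 : ∀ θ, ρ θ ≤ 1 := fun θ => RandomizedCLT.kolmogorovDist_cdf_le_one _ _
  have hi : Integrable ρ (RandomizedCLT.sphereMeasure n) :=
    Integrable.of_bound hρm.aestronglyMeasurable 1 (Filter.Eventually.of_forall fun θ => by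
      rw [Real.norm_eq_abs, abs_of_nonneg (hρ0 θ)]; exact hρ1 θ)
  have hi2 : Integrable (fun θ => ρ θ ^ 2) (RandomizedCLT.sphereMeasure n) :=
    Integrable.of_bound (hρm.pow_const 2).aestronglyMeasurable 1
      (Filter.Eventually.of_forall fun θ => by
        rw [Real.norm_eq_abs, abs_of_nonneg (sq_nonneg _)]
        exact pow_le_one₀ (hρ0 θ) (hρ1 θ))
  have hmain : ∫ θ, ρ θ ^ 2 ∂(RandomizedCLT.sphereMeasure n) ≤
      c * (1 + RandomizedCLT.sigma 1 X P ^ 2) * Real.log n ^ 2 / n := by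
    have h := (hX.isotropicLaw hn0).lintegral_sq_kolmogorovDist_le (by simp) hn2
    change ∫⁻ θ, ENNReal.ofReal (ρ θ ^ 2) ∂(RandomizedCLT.sphereMeasure n) ≤ _ at h
    rw [← ofReal_integral_eq_lintegral_ofReal hi2
      (Filter.Eventually.of_forall fun θ => sq_nonneg _),
      ENNReal.ofReal_le_ofReal_iff (by positivity)] at h
    refine h.trans (le_of_eq ?_)
    rw [RandomizedCLT.sigma_one_sq_eq hm, ← hc]
    field_simp
  refine ⟨hi2, hmain, fun h4 => ⟨hi, ?_, ?_⟩⟩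
  · exact Real.le_sqrt_of_sq_le (RandomizedCLT.sq_integral_le hi hi2)
  · have hσ := RandomizedCLT.sigma_one_sq_le hX hn0 h4
    have hσ0 : 0 ≤ RandomizedCLT.sigma 2 X P := by
      unfold RandomizedCLT.sigma
      positivity
    have hlog : 0 ≤ Real.log n := Real.log_nonneg (by linarith)
    refine Real.sqrt_le_iff.2 ⟨by positivity, hmain.trans ?_⟩
    rw [div_pow, Real.sq_sqrt hnR.le, mul_pow, mul_pow]
    -- After squaring, the target has constant `c²`; since `c ≥ 1`, the same `c` serves both bounds.
    have h1 : 1 + RandomizedCLT.sigma 1 X P ^ 2 ≤ (1 + RandomizedCLT.sigma 2 X P) ^ 2 := by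
      nlinarith
    have h2 : c ≤ c ^ 2 := by nlinarith
    gcongr
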